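/- All graphs are finite and simple. An outer-1-planar graph is a graph admitting a drawing in the plane (distinct vertices are distinct points; each edge is a simple arc joining its two ends and containing no other vertex) such that every vertex lies on the boundary of the outer (unbounded) face of the drawing and there is at most one crossing on each edge. Here a crossing on an edge $e$ is a point, other than an end of an edge, that $e$ shares with another edge; several edges sharing a point with $e$ count as several crossings. An outer-1-planar graph $G$ is maximal if for every two distinct non-adjacent vertices $u,v$ of $G$ the graph $G+uv$ is not outer-1-planar. Write $d(v)$ for the degree of $v$ and $\delta(G)$ for the minimum degree of $G$. (1) Every outer-1-planar graph $G$ with $\delta(G)\ge 2$ has an edge $uv$ with $d(u)+d(v)\le 9$. (2) Every maximal outer-1-planar graph $G$ with at least two vertices has an edge $uv$ with $d(u)+d(v)\le 7$. -/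

import Mathlib

/-- A drawing of a simple graph in the plane (identified with `ℂ`): distinct vertices are distinct
points, every edge is a simple continuous arc joining its two ends, and an arc contains
no vertex other than its two ends. -/
structure PlaneDrawing {V : Type*} (G : SimpleGraph V) where
  point : V → ℂ
  point_injective : Function.Injective point
  arc : G.edgeSet → Set ℂ
  arc_spec : ∀ (u v : V) (h : G.Adj u v), ∃ γ : Path (point u) (point v),
    Function.Injective γ ∧ Set.range γ = arc ⟨s(u, v), G.mem_edgeSet.mpr h⟩
  mem_of_point_mem_arc : ∀ (e : G.edgeSet) (w : V), point w ∈ arc e → w ∈ (e : Sym2 V)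

namespace PlaneDrawing

variable {V : Type*} {G : SimpleGraph V}

/-- The set of all points of the plane covered by the drawing. -/
def carrier (D : PlaneDrawing G) : Set ℂ :=
  Set.range D.point ∪ ⋃ e, D.arc e

/-- The arc of an edge without its two ends. -/
def inner (D : PlaneDrawing G) (e : G.edgeSet) : Set ℂ :=
  D.arc e \ Set.range D.point

/-- The crossings on the edge `e`: pairs of another edge and a common inner point of the two.
Every common inner point counts, and several edges through one point count separately. -/
def crossings (D : PlaneDrawing G) (e : G.edgeSet) : Set (G.edgeSet × ℂ) :=
  {c | c.1 ≠ e ∧ c.2 ∈ D.inner e ∧ c.2 ∈ D.inner c.1}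

/-- The outer face: the unbounded connected component of the complement of the drawing. -/
def outerFace (D : PlaneDrawing G) : Set ℂ :=
  {p | p ∈ D.carrierᶜ ∧ ¬ Bornology.IsBounded (connectedComponentIn D.carrierᶜ p)}

/-- There is at most one crossing on each edge, and all vertices are incident with (lie on the
boundary of) the outer face. -/
def IsOuterOnePlane (D : PlaneDrawing G) : Prop :=
  (∀ e, (D.crossings e).Subsingleton) ∧ ∀ v, D.point v ∈ frontier D.outerFace

end PlaneDrawing

/-- A graph is outer-1-planar if it has an outer-1-plane drawing. -/
def IsOuterOnePlanar {V : Type*} (G : SimpleGraph V) : Prop :=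
  ∃ D : PlaneDrawing G, D.IsOuterOnePlane

/-- An outer-1-planar graph is maximal if adding any edge between two distinct non-adjacent
vertices gives a graph that is not outer-1-planar (in any drawing). -/
def IsMaximalOuterOnePlanar {V : Type*} (G : SimpleGraph V) : Prop :=
  IsOuterOnePlanar G ∧
    ∀ u v : V, u ≠ v → ¬ G.Adj u v → ¬ IsOuterOnePlanar (G ⊔ SimpleGraph.edge u v)

/-! Both bounds reduce to the combinatorics of chords. An outer-1-planar graph can be placed on a
circle so that every edge, seen as a chord, is crossed by at most one other edge
(`IsConvexOnePlane`). For this, `exists_homeomorph_closedBall` finds a topological disc inside the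
connected outer face that comes close to every vertex. Short legs prolong the edges to the boundary
of the disc, where the vertices receive a cyclic order. Two prolonged edges with alternating ends
must meet: otherwise they, four boundary arcs and four radii would draw K5 with no two non-adjacent
edges meeting. `not_drawing_completeGraph_five` excludes that by a parity count of winding numbers.
Conversely, chords of the unit circle turn a convex placement into a drawing, so maximality can be
tested on placements.

For chords, `exists_cell` splits the region below an uncrossed chord into a triangle or a quadrangle
with uncrossed sides. Induct on the span of the chord. When no light edge has been found, the sides
are short: a side is either a step between consecutive places or spans a bounded number of places
and covers a vertex of degree at most 2 adjacent to its ends. Short sides bound the degrees of the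
inner corners, so such a low vertex and an inner corner form a light edge. The quadrangle is the
worst case, with 2 + 7 = 9 in general. In a maximal graph consecutive places are adjacent and a
triangle cannot have a long side, so spans are at most 2 and the weight drops to 2 + 5 = 7. -/

open Filter Topology

/-! ### Winding numbers and the non-planarity of K5 -/

/-- A continuous nowhere vanishing function on a simply connected, locally path connected space has
a continuous logarithm. -/
theorem exists_continuous_log {A : Type*} [TopologicalSpace A] [SimplyConnectedSpace A]
    [LocallyPathConnectedSpace A] (f : A → ℂ) (hf : Continuous f) (h0 : ∀ a, f a ≠ 0) (a₀ : A) :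
    ∃ F : A → ℂ, Continuous F ∧ ∀ a, Complex.exp (F a) = f a := by
  obtain ⟨F, ⟨-, hF⟩, -⟩ := Complex.isCoveringMapOn_exp.existsUnique_continuousMap_lifts
    (⟨f, hf⟩ : C(A, ℂ)) (a₀ := a₀) (e₀ := Complex.log (f a₀)) (by simp [Complex.exp_log (h0 a₀)])
    (fun a => by simpa using h0 a)
  exact ⟨F, F.continuous, fun a => congrFun hF a⟩

/-- Uniqueness of lifts through `exp`: logarithms of proportional functions differ by a constant.
Hence `logChange` does not depend on the logarithm chosen in its definition. -/
theorem exp_log_sub_eq {A : Type*} [TopologicalSpace A] [SimplyConnectedSpace A]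
    [LocallyPathConnectedSpace A] (F G : A → ℂ) (hF : Continuous F) (hG : Continuous G)
    (c : ℂ) (h : ∀ a, Complex.exp (F a) = c * Complex.exp (G a)) (x y : A) :
    F x - F y = G x - G y := by
  have hu := Complex.isCoveringMapOn_exp.existsUnique_continuousMap_lifts
    (⟨fun a => Complex.exp (F a), by fun_prop⟩ : C(A, ℂ)) (a₀ := y) (e₀ := F y) rfl
    (fun a => by simp)
  have h1 := hu.unique (y₁ := ⟨F, hF⟩) (y₂ := ⟨fun a => G a + (F y - G y), by fun_prop⟩)
    ⟨rfl, rfl⟩ ⟨by simp, by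
      ext a
      have := h y
      simp only [ContinuousMap.coe_mk, Function.comp_apply, Complex.exp_add, Complex.exp_sub]
      rw [h a, this]
      field_simp⟩
  have := DFunLike.congr_fun h1 x
  simp only [ContinuousMap.coe_mk] at this
  rw [this]; ring

open Classical in
/-- The change of `log (z - w)` as `z` runs along the path `γ`. -/
noncomputable def logChange {a b : ℂ} (γ : Path a b) (w : ℂ) : ℂ :=
  if h : ∃ g : ℝ → ℂ, Continuous g ∧ ∀ t, Complex.exp (g t) = γ.extend t - w then
    h.choose 1 - h.choose 0 else 0

theorem logChange_eq {a b : ℂ} (γ : Path a b) (w c : ℂ) (hc : c ≠ 0) (g : ℝ → ℂ)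
    (hg : Continuous g) (h : ∀ t, Complex.exp (g t) = c * (γ.extend t - w)) :
    logChange γ w = g 1 - g 0 := by
  have h' : ∃ g : ℝ → ℂ, Continuous g ∧ ∀ t, Complex.exp (g t) = γ.extend t - w := by
    refine ⟨fun t => g t - Complex.log c, by fun_prop, fun t => ?_⟩
    rw [Complex.exp_sub, h, Complex.exp_log hc]; field_simp
  rw [logChange, dif_pos h']
  refine (exp_log_sub_eq _ _ hg h'.choose_spec.1 c (fun t => ?_) _ _).symm
  rw [h, h'.choose_spec.2]

theorem extend_mem_range {a b : ℂ} (γ : Path a b) (t : ℝ) : γ.extend t ∈ Set.range γ := by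
  rw [← γ.extend_range]; exact ⟨t, rfl⟩

theorem exp_logChange {a b : ℂ} (γ : Path a b) (w : ℂ) (hw : w ∉ Set.range γ) :
    Complex.exp (logChange γ w) = (b - w) / (a - w) := by
  obtain ⟨g, hg, h⟩ := exists_continuous_log (fun t : ℝ => γ.extend t - w)
    (γ.continuous_extend.sub continuous_const)
    (fun t => sub_ne_zero.2 fun e => hw (e ▸ extend_mem_range γ t)) 0
  rw [logChange_eq γ w 1 one_ne_zero g hg (by simpa using h), Complex.exp_sub, h, h]
  simp

/-- Disjoint paths rotate about each other's ends compatibly. -/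
theorem logChange_sub_logChange {a b c d : ℂ} (γ : Path a b) (η : Path c d)
    (h : Disjoint (Set.range γ) (Set.range η)) :
    logChange γ d - logChange γ c = logChange η b - logChange η a := by
  -- Extending the paths to ℝ makes the difference a nowhere vanishing function on the simply
  -- connected plane ℝ × ℝ. One logarithm `F` then computes all four changes along the sides of the
  -- unit square.
  obtain ⟨F, hF, hE⟩ := exists_continuous_log (fun p : ℝ × ℝ => γ.extend p.1 - η.extend p.2)
    ((γ.continuous_extend.comp continuous_fst).sub (η.continuous_extend.comp continuous_snd))
    (fun p => sub_ne_zero.2 fun e => Set.disjoint_left.1 h (extend_mem_range γ p.1)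
      (e ▸ extend_mem_range η p.2)) 0
  have h1 := logChange_eq γ d 1 one_ne_zero (fun t => F (t, 1)) (by fun_prop)
    (fun t => by rw [hE]; simp)
  have h2 := logChange_eq γ c 1 one_ne_zero (fun t => F (t, 0)) (by fun_prop)
    (fun t => by rw [hE]; simp)
  -- Seen from `η` the difference has the opposite sign, hence the factor `-1`.
  have h3 := logChange_eq η b (-1) (by simp) (fun t => F (1, t)) (by fun_prop)
    (fun t => by rw [hE]; simp)
  have h4 := logChange_eq η a (-1) (by simp) (fun t => F (0, t)) (by fun_prop)
    (fun t => by rw [hE]; simp)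
  rw [h1, h2, h3, h4]; ring

/-- The two paths `γ` and `η` have no common point. -/
abbrev Path.Avoids {a b c d : ℂ} (γ : Path a b) (η : Path c d) : Prop :=
  Disjoint (Set.range γ) (Set.range η)

theorem exists_logChange_eq {a b w : ℂ} (γ : Path a b) (hw : w ∉ Set.range γ) :
    ∃ n : ℤ, logChange γ w =
      Complex.log (b - w) - Complex.log (a - w) + n * (2 * Real.pi * Complex.I) := by
  have ha : a - w ≠ 0 := sub_ne_zero.2 fun e => hw (e ▸ ⟨0, γ.source⟩)
  have hb : b - w ≠ 0 := sub_ne_zero.2 fun e => hw (e ▸ ⟨1, γ.target⟩)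
  apply Complex.exp_eq_exp_iff_exists_int.1
  rw [exp_logChange γ w hw, Complex.exp_sub, Complex.exp_log ha, Complex.exp_log hb]

open Classical in
/-- The number of full turns made by `z - w` along `γ`, relative to the principal logarithm. -/
noncomputable def turns {a b : ℂ} (γ : Path a b) (w : ℂ) : ℤ :=
  if h : ∃ n : ℤ, logChange γ w =
      Complex.log (b - w) - Complex.log (a - w) + n * (2 * Real.pi * Complex.I) then
    h.choose else 0

theorem logChange_eq_turns {a b w : ℂ} (γ : Path a b) (hw : w ∉ Set.range γ) :
    logChange γ w =
      Complex.log (b - w) - Complex.log (a - w) + turns γ w * (2 * Real.pi * Complex.I) := by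
  have h := exists_logChange_eq γ hw
  rw [turns, dif_pos h]
  exact h.choose_spec

/-- The quotient of the two arguments is -1, so the logarithms differ by an odd multiple of πi. This
oddness is what drives the parity count for K5. -/
theorem exists_log_neg (z w : ℂ) (h : z ≠ w) : ∃ m : ℤ, m % 2 = 1 ∧
    Complex.log (w - z) - Complex.log (z - w) = m * (Real.pi * Complex.I) := by
  have h1 : Complex.exp (Complex.log (w - z) - Complex.log (z - w)) =
      Complex.exp (Real.pi * Complex.I) := by
    have h2 : z - w ≠ 0 := sub_ne_zero.2 h
    rw [Complex.exp_sub, Complex.exp_log (sub_ne_zero.2 h.symm),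
      Complex.exp_log h2, Complex.exp_pi_mul_I]
    field_simp; ring
  obtain ⟨n, hn⟩ := Complex.exp_eq_exp_iff_exists_int.1 h1
  refine ⟨2 * n + 1, by omega, ?_⟩
  rw [hn]; push_cast; ring

open Classical in
/-- The difference of the principal logarithms of `w - z` and `z - w` in units of `π * I`. -/
noncomputable def halfTurns (z w : ℂ) : ℤ :=
  if h : z ≠ w then (exists_log_neg z w h).choose else 0

theorem halfTurns_spec {z w : ℂ} (h : z ≠ w) : halfTurns z w % 2 = 1 ∧
    Complex.log (w - z) - Complex.log (z - w) = halfTurns z w * (Real.pi * Complex.I) := by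
  rw [halfTurns, dif_pos h]
  exact (exists_log_neg z w h).choose_spec

theorem pi_mul_I_ne_zero : (Real.pi * Complex.I : ℂ) ≠ 0 :=
  mul_ne_zero (by exact_mod_cast Real.pi_ne_zero) Complex.I_ne_zero

theorem halfTurns_swap {z w : ℂ} (h : z ≠ w) :
    halfTurns z w % 2 = 1 ∧ halfTurns w z = -halfTurns z w := by
  refine ⟨(halfTurns_spec h).1, ?_⟩
  have h1 := (halfTurns_spec h).2
  have h2 := (halfTurns_spec h.symm).2
  have : ((halfTurns w z : ℤ) : ℂ) = ((-halfTurns z w : ℤ) : ℂ) := by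
    apply mul_right_cancel₀ pi_mul_I_ne_zero
    push_cast
    rw [← h2, neg_mul, ← h1]; ring
  exact_mod_cast this

/-- A relation between the winding numbers of two disjoint paths around each other's ends. -/
theorem Path.Avoids.turns_eq {a b c d : ℂ} {γ : Path a b} {η : Path c d} (h : γ.Avoids η) :
    2 * (turns γ d - turns γ c - turns η b + turns η a) =
      halfTurns b d - halfTurns b c - halfTurns a d + halfTurns a c := by
  have hc : c ∉ Set.range γ := fun e => Set.disjoint_left.1 h e ⟨0, η.source⟩
  have hd : d ∉ Set.range γ := fun e => Set.disjoint_left.1 h e ⟨1, η.target⟩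
  have ha : a ∉ Set.range η := fun e => Set.disjoint_left.1 h ⟨0, γ.source⟩ e
  have hb : b ∉ Set.range η := fun e => Set.disjoint_left.1 h ⟨1, γ.target⟩ e
  have h0 := logChange_sub_logChange γ η h
  rw [logChange_eq_turns γ hc, logChange_eq_turns γ hd, logChange_eq_turns η ha,
    logChange_eq_turns η hb] at h0
  have h1 := (halfTurns_spec (z := b) (w := d) fun e => hd (e ▸ ⟨1, γ.target⟩)).2
  have h2 := (halfTurns_spec (z := b) (w := c) fun e => hc (e ▸ ⟨1, γ.target⟩)).2
  have h3 := (halfTurns_spec (z := a) (w := d) fun e => hd (e ▸ ⟨0, γ.source⟩)).2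
  have h4 := (halfTurns_spec (z := a) (w := c) fun e => hc (e ▸ ⟨0, γ.source⟩)).2
  have : ((2 * (turns γ d - turns γ c - turns η b + turns η a) : ℤ) : ℂ) =
      ((halfTurns b d - halfTurns b c - halfTurns a d + halfTurns a c : ℤ) : ℂ) := by
    apply mul_right_cancel₀ pi_mul_I_ne_zero
    push_cast
    linear_combination h0 + h1 - h2 - h3 + h4
  exact_mod_cast this

/-- The complete graph on five vertices cannot be drawn in the plane in such a way that
non-adjacent edges have no common point. -/
theorem not_drawing_completeGraph_five {a b c d e : ℂ} (ab : Path a b) (ac : Path a c)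
    (ad : Path a d) (ae : Path a e) (bc : Path b c) (bd : Path b d) (be : Path b e)
    (cd : Path c d) (ce : Path c e) (de : Path d e)
    (h1 : ab.Avoids cd) (h2 : ab.Avoids ce) (h3 : ab.Avoids de)
    (h4 : ac.Avoids bd) (h5 : ac.Avoids be) (h6 : ac.Avoids de)
    (h7 : ad.Avoids bc) (h8 : ad.Avoids be) (h9 : ad.Avoids ce)
    (h10 : ae.Avoids bc) (h11 : ae.Avoids bd) (h12 : ae.Avoids cd)
    (h13 : bc.Avoids de) (h14 : bd.Avoids ce) (h15 : be.Avoids cd) : False := by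
  have ne : ∀ {x y z w : ℂ} {γ : Path x y} {η : Path z w}, γ.Avoids η →
      x ≠ z ∧ x ≠ w ∧ y ≠ z ∧ y ≠ w := by
    intro x y z w γ η h
    have h := Set.disjoint_iff_forall_ne.1 h
    exact ⟨h ⟨0, γ.source⟩ ⟨0, η.source⟩, h ⟨0, γ.source⟩ ⟨1, η.target⟩,
      h ⟨1, γ.target⟩ ⟨0, η.source⟩, h ⟨1, γ.target⟩ ⟨1, η.target⟩⟩
  have s1 := halfTurns_swap (ne h4).1
  have s2 := halfTurns_swap (ne h1).1
  have s3 := halfTurns_swap (ne h1).2.1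
  have s4 := halfTurns_swap (ne h2).2.1
  have s5 := halfTurns_swap (ne h1).2.2.1
  have s6 := halfTurns_swap (ne h1).2.2.2
  have s7 := halfTurns_swap (ne h2).2.2.2
  have s8 := halfTurns_swap (ne h4).2.2.2
  have s9 := halfTurns_swap (ne h6).2.2.2
  have s10 := halfTurns_swap (ne h9).2.2.2
  -- Add all fifteen relations. Each `turns` of an edge about a vertex occurs twice, so the left
  -- side is 0 modulo 4. Each of the ten odd `halfTurns` occurs six times up to sign; counting the
  -- signs, including those from swapped arguments, gives 2 modulo 4 on the right.
  have t1 := h1.turns_eq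
  have t2 := h2.turns_eq
  have t3 := h3.turns_eq
  have t4 := h4.turns_eq
  have t5 := h5.turns_eq
  have t6 := h6.turns_eq
  have t7 := h7.turns_eq
  have t8 := h8.turns_eq
  have t9 := h9.turns_eq
  have t10 := h10.turns_eq
  have t11 := h11.turns_eq
  have t12 := h12.turns_eq
  have t13 := h13.turns_eq
  have t14 := h14.turns_eq
  have t15 := h15.turns_eq
  omega

/-! ### Discs in connected open sets of the plane -/

/-- A union of circles whose radii form an interval of positive numbers is connected. -/
theorem isPreconnected_dist_mem (c : ℂ) {s : Set ℝ} (hs : IsPreconnected s)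
    (h0 : ∀ r ∈ s, 0 < r) : IsPreconnected {z : ℂ | dist z c ∈ s} := by
  have h1 : IsPreconnected ((fun p : ℝ × ℝ => c + p.1 * Complex.exp (p.2 * Complex.I)) ''
      (s ×ˢ Set.univ)) :=
    (hs.prod isPreconnected_univ).image _ (by fun_prop)
  convert h1 using 1
  ext z
  constructor
  · intro hz
    refine ⟨(dist z c, Complex.arg (z - c)), ⟨hz, trivial⟩, ?_⟩
    simp only [Complex.dist_eq]
    rw [Complex.norm_mul_exp_arg_mul_I]; ring
  · rintro ⟨⟨r, t⟩, ⟨hr, -⟩, rfl⟩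
    simp only [Set.mem_ofPred_eq, Complex.dist_eq, add_sub_cancel_left, norm_mul,
      Complex.norm_exp_ofReal_mul_I, mul_one, Complex.norm_real, Real.norm_eq_abs]
    rw [abs_of_pos (h0 r hr)]; exact hr

/-- A punctured disc around `s` is connected, so it lies on one side of any separation of `U \ {s}`.
Adding `s` to that side would separate `U`. -/
theorem IsPreconnected.diff_singleton_of_isOpen {U : Set ℂ} (hU : IsOpen U)
    (hc : IsPreconnected U) (s : ℂ) : IsPreconnected (U \ {s}) := by
  by_cases hs : s ∈ U
  swap
  · rwa [Set.sdiff_singleton_eq_self hs]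
  obtain ⟨r, hr, hrU⟩ := Metric.isOpen_iff.1 hU s hs
  have hB : IsPreconnected (Metric.ball s r \ {s}) := by
    have := isPreconnected_dist_mem s (isPreconnected_Ioo (a := 0) (b := r)) (fun r h => h.1)
    convert this using 1
    ext z; simp [dist_pos, and_comm]
  have hne : ∀ A : Set ℂ, IsOpen A → s ∈ A → ((Metric.ball s r \ {s}) ∩ A).Nonempty := by
    intro A hA hsA
    obtain ⟨z, hz⟩ := (dense_compl_singleton s).inter_open_nonempty _
      (hA.inter Metric.isOpen_ball) ⟨s, hsA, Metric.mem_ball_self hr⟩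
    exact ⟨z, ⟨hz.1.2, hz.2⟩, hz.1.1⟩
  have hsub : Metric.ball s r \ {s} ⊆ U \ {s} := Set.sdiff_subset_sdiff_left hrU
  have key : ∀ A B : Set ℂ, IsOpen A → IsOpen B → U \ {s} ⊆ A ∪ B →
      (U \ {s} ∩ A).Nonempty → (U \ {s} ∩ B).Nonempty → (∀ z ∈ U \ {s}, z ∈ A → z ∉ B) →
      Metric.ball s r \ {s} ⊆ A → False := by
    intro A B hA hB' hcov hAn hBn hd hBA
    have hsB : s ∉ B := fun h => by
      obtain ⟨z, hz, hzB⟩ := hne B hB' h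
      exact hd z (hsub hz) (hBA hz) hzB
    have := hc (A ∪ Metric.ball s r) B (hA.union Metric.isOpen_ball) hB' (fun z hz => by
      by_cases h : z = s
      · exact Or.inl (Or.inr (h ▸ Metric.mem_ball_self hr))
      · rcases hcov ⟨hz, h⟩ with h | h
        · exact Or.inl (Or.inl h)
        · exact Or.inr h)
      (hAn.mono fun z hz => ⟨hz.1.1, Or.inl hz.2⟩) (hBn.mono fun z hz => ⟨hz.1.1, hz.2⟩)
    obtain ⟨z, hz, hzA, hzB⟩ := this
    have hzs : z ≠ s := fun e => hsB (e ▸ hzB)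
    rcases hzA with h | h
    · exact hd z ⟨hz, hzs⟩ h hzB
    · exact hd z ⟨hz, hzs⟩ (hBA ⟨h, hzs⟩) hzB
  rw [isPreconnected_iff_subset_of_disjoint] at hB ⊢
  intro A B hA hB' hcov hd
  by_contra! hcon
  have hd' : ∀ z ∈ U \ {s}, z ∈ A → z ∉ B := fun z hz hzA hzB =>
    (Set.eq_empty_iff_forall_notMem.1 hd) z ⟨hz, hzA, hzB⟩
  obtain ⟨x, hx, hxA⟩ := Set.not_subset.1 hcon.1
  obtain ⟨y, hy, hyB⟩ := Set.not_subset.1 hcon.2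
  have hxB := (hcov hx).resolve_left hxA
  have hyA := (hcov hy).resolve_right hyB
  rcases hB A B hA hB' (hsub.trans hcov)
    (Set.eq_empty_iff_forall_notMem.2 fun z hz => hd' z (hsub hz.1) hz.2.1 hz.2.2) with h | h
  · exact key A B hA hB' hcov ⟨y, hy, hyA⟩ ⟨x, hx, hxB⟩ hd' h
  · exact key B A hB' hA (Set.union_comm A B ▸ hcov) ⟨x, hx, hxB⟩ ⟨y, hy, hyA⟩
      (fun z hz hB hA => hd' z hz hA hB) h

/-- Adding to the identity a small multiple of a tent function is a homeomorphism. -/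
theorem exists_homeomorph_ball (x : ℂ) {r : ℝ} (hr : 0 < r) {y : ℂ} (hy : y ∈ Metric.ball x r) :
    ∃ h : ℂ ≃ₜ ℂ, h x = y ∧ ∀ z ∉ Metric.ball x r, h z = z := by
  set f : ℂ → ℂ := fun z => z + (max 0 (1 - ‖z - x‖ / r) : ℝ) * (y - x) with hf
  have hyx : ‖y - x‖ < r := by simpa [Complex.dist_eq] using hy
  have hk1 : ‖y - x‖ / r < 1 := (div_lt_one hr).2 hyx
  have hk0 : 0 ≤ ‖y - x‖ / r := by positivity
  -- The added term is Lipschitz with constant `‖y - x‖ / r < 1`, so the map is a global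
  -- homeomorphism.
  have hap : ApproximatesLinearOn f ((ContinuousLinearEquiv.refl ℝ ℂ : ℂ ≃L[ℝ] ℂ) : ℂ →L[ℝ] ℂ)
      Set.univ (‖y - x‖ / r).toNNReal := by
    intro z _ w _
    have h1 : f z - f w - (ContinuousLinearEquiv.refl ℝ ℂ : ℂ ≃L[ℝ] ℂ) (z - w) =
        ((max 0 (1 - ‖z - x‖ / r) - max 0 (1 - ‖w - x‖ / r) : ℝ) : ℂ) * (y - x) := by
      simp only [hf, ContinuousLinearEquiv.refl_apply]; push_cast; ring
    have h2 : |max 0 (1 - ‖z - x‖ / r) - max 0 (1 - ‖w - x‖ / r)| ≤ ‖z - w‖ / r := by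
      rw [max_comm, max_comm 0]
      refine (abs_max_sub_max_le_abs _ _ _).trans ?_
      have : 1 - ‖z - x‖ / r - (1 - ‖w - x‖ / r) = (‖w - x‖ - ‖z - x‖) / r := by ring
      rw [this, abs_div, abs_of_pos hr]
      gcongr
      have := abs_norm_sub_norm_le (w - x) (z - x)
      rwa [sub_sub_sub_cancel_right, norm_sub_rev w z] at this
    change ‖f z - f w - (ContinuousLinearEquiv.refl ℝ ℂ : ℂ ≃L[ℝ] ℂ) (z - w)‖ ≤ _
    rw [h1, norm_mul, Complex.norm_real, Real.norm_eq_abs]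
    calc _ ≤ ‖z - w‖ / r * ‖y - x‖ := by gcongr
      _ = (‖y - x‖ / r).toNNReal * ‖z - w‖ := by rw [Real.coe_toNNReal _ hk0]; ring
  refine ⟨hap.toHomeomorph f (Or.inr ?_), ?_, ?_⟩
  · have h1 : ‖((ContinuousLinearEquiv.refl ℝ ℂ).symm : ℂ →L[ℝ] ℂ)‖₊ = 1 := by
      rw [← NNReal.coe_inj]
      exact ContinuousLinearMap.norm_id
    rw [h1, inv_one, ← NNReal.coe_lt_coe, Real.coe_toNNReal _ hk0]
    exact hk1
  · change f x = y
    simp [hf]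
  · intro z hz
    change f z = z
    have : 1 ≤ ‖z - x‖ / r := by
      rw [le_div_iff₀ hr, one_mul]; simpa [Complex.dist_eq] using hz
    simp only [hf]
    rw [max_eq_left (by linarith)]; simp

/-- The homeomorphisms of the plane supported in a connected open set act transitively on it. -/
theorem IsPreconnected.exists_homeomorph {U : Set ℂ} (hU : IsOpen U) (hc : IsPreconnected U)
    {x y : ℂ} (hx : x ∈ U) (hy : y ∈ U) :
    ∃ h : ℂ ≃ₜ ℂ, h x = y ∧ ∀ z ∉ U, h z = z := by
  refine hc.induction₂' (fun x y => ∃ h : ℂ ≃ₜ ℂ, h x = y ∧ ∀ z ∉ U, h z = z) ?_ ?_ hx hy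
  · intro x hx
    obtain ⟨r, hr, hrU⟩ := Metric.isOpen_iff.1 hU x hx
    filter_upwards [mem_nhdsWithin_of_mem_nhds (Metric.ball_mem_nhds x hr)] with y hy
    obtain ⟨h, h1, h2⟩ := exists_homeomorph_ball x hr hy
    refine ⟨⟨h, h1, fun z hz => h2 z fun h => hz (hrU h)⟩,
      ⟨h.symm, by rw [← h1]; simp, fun z hz => ?_⟩⟩
    rw [Homeomorph.symm_apply_eq, h2 z fun h => hz (hrU h)]
  · rintro x y z - - - ⟨h, h1, h2⟩ ⟨k, k1, k2⟩
    exact ⟨h.trans k, by simp [h1, k1], fun w hw => by simp [h2 w hw, k2 w hw]⟩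

/-- Finitely many points of a connected open set lie in a disc inside this set. -/
theorem exists_homeomorph_closedBall {U : Set ℂ} (hU : IsOpen U) (hc : IsPreconnected U)
    (hne : U.Nonempty) (S : Finset ℂ) (hS : ∀ s ∈ S, s ∈ U) :
    ∃ h : ℂ ≃ₜ ℂ, h '' Metric.closedBall 0 1 ⊆ U ∧ ∀ s ∈ S, s ∈ h '' Metric.closedBall 0 1 := by
  induction S using Finset.induction_on with
  | empty =>
    obtain ⟨x, hx⟩ := hne
    obtain ⟨r, hr, hrU⟩ := Metric.isOpen_iff.1 hU x hx
    have hr2 : r / 2 ≠ 0 := by positivity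
    let m : ℂ ≃ₜ ℂ := Homeomorph.mulLeft₀ ((r / 2 : ℝ) : ℂ) (by exact_mod_cast hr2)
    refine ⟨m.trans (Homeomorph.addLeft x), ?_, by simp⟩
    rintro _ ⟨z, hz, rfl⟩
    apply hrU
    simp only [Homeomorph.trans_apply, m, Homeomorph.coe_mulLeft₀, Homeomorph.coe_addLeft,
      Metric.mem_ball, dist_self_add_left, norm_mul, Complex.norm_real, Real.norm_eq_abs]
    rw [abs_of_pos (by positivity)]
    have : ‖z‖ ≤ 1 := by simpa using hz
    nlinarith
  | insert s S hsS ih =>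
    obtain ⟨h, h1, h2⟩ := ih fun t ht => hS t (Finset.mem_insert_of_mem ht)
    by_cases hs : s ∈ h '' Metric.closedBall 0 1
    · refine ⟨h, h1, fun t ht => ?_⟩
      rcases Finset.mem_insert.1 ht with rfl | ht
      exacts [hs, h2 t ht]
    have hinf : (h '' Metric.closedBall 0 1).Infinite := by
      refine Set.Infinite.image h.injective.injOn ?_
      exact infinite_of_mem_nhds (0 : ℂ) (Metric.closedBall_mem_nhds 0 one_pos)
    -- A point of the current disc off `S` is pushed to `s` inside `U \ S`, which is still
    -- connected. The push fixes every point of `S`, so these stay in the image disc.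
    obtain ⟨r, hr, hrS⟩ := (hinf.sdiff S.finite_toSet).nonempty
    have hcS : ∀ T : Finset ℂ, IsPreconnected (U \ T) := by
      intro T
      induction T using Finset.induction_on with
      | empty => simpa using hc
      | insert t T _ iht =>
        have := IsPreconnected.diff_singleton_of_isOpen
          (hU.sdiff T.finite_toSet.isClosed) iht t
        rwa [Set.sdiff_sdiff, Set.union_comm, Set.singleton_union, ← Finset.coe_insert] at this
    obtain ⟨k, k1, k2⟩ := (hcS S).exists_homeomorph (hU.sdiff S.finite_toSet.isClosed)
      (x := r) (y := s) ⟨h1 hr, hrS⟩ ⟨hS s (Finset.mem_insert_self s S), by simpa using hsS⟩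
    have kU : ∀ z ∈ U, k z ∈ U := fun z hz => by
      by_contra hkz
      have : k (k z) = k z := k2 _ fun h => hkz h.1
      rw [k.injective this] at hkz
      exact hkz hz
    refine ⟨h.trans k, ?_, fun t ht => ?_⟩
    · rintro _ ⟨z, hz, rfl⟩
      exact kU _ (h1 ⟨z, hz, rfl⟩)
    rcases Finset.mem_insert.1 ht with rfl | ht
    · obtain ⟨z, hz, rfl⟩ := hr
      exact ⟨z, hz, k1⟩
    · obtain ⟨z, hz, e⟩ := h2 t ht
      refine ⟨z, hz, ?_⟩
      simp only [Homeomorph.trans_apply]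
      rw [e]
      exact k2 t fun h => h.2 (by simpa using ht)

/-! ### Arcs and radii of the unit disc; alternating paths outside it -/

theorem exp_mul_I_inj {r s : ℝ} (h : Complex.exp (r * Complex.I) = Complex.exp (s * Complex.I))
    (h1 : r - s < 2 * Real.pi) (h2 : s - r < 2 * Real.pi) : r = s := by
  obtain ⟨n, hn⟩ := Complex.exp_eq_exp_iff_exists_int.1 h
  have hr : r = s + n * (2 * Real.pi) := by
    have := congrArg Complex.im hn
    simpa using this
  have hp := Real.pi_pos
  have hn1 : (n : ℝ) < 1 := by
    by_contra! hh
    nlinarith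
  have hn2 : (-1 : ℝ) < n := by
    by_contra! hh
    nlinarith
  have : n = 0 := by
    have a1 : n < 1 := by exact_mod_cast hn1
    have a2 : -1 < n := by exact_mod_cast hn2
    omega
  simpa [this] using hr

/-- The arc of the unit circle from angle `s` to angle `t`. -/
noncomputable def circleArc (s t : ℝ) :
    Path (Complex.exp (s * Complex.I)) (Complex.exp (t * Complex.I)) where
  toFun u := Complex.exp (((s + u * (t - s) : ℝ) : ℂ) * Complex.I)
  source' := by simp
  target' := by simp

theorem exists_of_mem_circleArc {s t : ℝ} (h : s ≤ t) {z : ℂ} (hz : z ∈ Set.range (circleArc s t)) :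
    ∃ r : ℝ, s ≤ r ∧ r ≤ t ∧ z = Complex.exp (r * Complex.I) := by
  obtain ⟨u, rfl⟩ := hz
  refine ⟨s + u * (t - s), ?_, ?_, rfl⟩
  · have := mul_nonneg u.2.1 (sub_nonneg.2 h); linarith
  · have := mul_le_mul_of_nonneg_right u.2.2 (sub_nonneg.2 h); linarith

/-- The radius of the unit disc at angle `s`. -/
noncomputable def spoke (s : ℝ) : Path (Complex.exp (s * Complex.I)) 0 where
  toFun u := ((1 - u : ℝ) : ℂ) * Complex.exp (s * Complex.I)
  source' := by simp
  target' := by simp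

theorem exists_of_mem_spoke {s : ℝ} {z : ℂ} (hz : z ∈ Set.range (spoke s)) :
    ∃ r : ℝ, 0 ≤ r ∧ r ≤ 1 ∧ z = r * Complex.exp (s * Complex.I) := by
  obtain ⟨u, rfl⟩ := hz
  exact ⟨1 - u, by linarith [u.2.2], by linarith [u.2.1], rfl⟩

theorem norm_ofReal_mul_exp {r s : ℝ} (h : 0 ≤ r) : ‖r * Complex.exp (s * Complex.I)‖ = r := by
  rw [norm_mul, Complex.norm_exp_ofReal_mul_I, Complex.norm_real, mul_one, Real.norm_of_nonneg h]

theorem circleArc_avoids_spoke {s t θ : ℝ} (hst : s ≤ t)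
    (h : ∀ r, s ≤ r → r ≤ t → r ≠ θ ∧ r - θ < 2 * Real.pi ∧ θ - r < 2 * Real.pi) :
    (circleArc s t).Avoids (spoke θ) := by
  refine Set.disjoint_left.2 fun z hz hz' => ?_
  obtain ⟨r, h1, h2, rfl⟩ := exists_of_mem_circleArc hst hz
  obtain ⟨ρ, h3, h4, e⟩ := exists_of_mem_spoke hz'
  have : ρ = 1 := by
    rw [← norm_ofReal_mul_exp (s := θ) h3, ← e, Complex.norm_exp_ofReal_mul_I]
  rw [this, Complex.ofReal_one, one_mul] at e
  exact (h r h1 h2).1 (exp_mul_I_inj e (h r h1 h2).2.1 (h r h1 h2).2.2)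

theorem circleArc_avoids_circleArc {s t s' t' : ℝ} (hst : s ≤ t) (hst' : s' ≤ t')
    (h1 : t < s') (h2 : t' - s < 2 * Real.pi) : (circleArc s t).Avoids (circleArc s' t') := by
  refine Set.disjoint_left.2 fun z hz hz' => ?_
  obtain ⟨r, h3, h4, rfl⟩ := exists_of_mem_circleArc hst hz
  obtain ⟨r', h5, h6, e⟩ := exists_of_mem_circleArc hst' hz'
  have := exp_mul_I_inj e (by linarith) (by linarith)
  linarith

theorem avoids_spoke {s t θ : ℝ}
    (P : Path (Complex.exp (s * Complex.I)) (Complex.exp (t * Complex.I)))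
    (hP : ∀ u, ‖P u‖ ≤ 1 → P u = Complex.exp (s * Complex.I) ∨ P u = Complex.exp (t * Complex.I))
    (hs : s ≠ θ ∧ s - θ < 2 * Real.pi ∧ θ - s < 2 * Real.pi)
    (ht : t ≠ θ ∧ t - θ < 2 * Real.pi ∧ θ - t < 2 * Real.pi) : P.Avoids (spoke θ) := by
  refine Set.disjoint_left.2 ?_
  rintro _ ⟨u, rfl⟩ hz
  obtain ⟨ρ, h3, h4, e⟩ := exists_of_mem_spoke hz
  have h5 : ‖P u‖ = ρ := by rw [e, norm_ofReal_mul_exp h3]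
  have key : ∀ s' : ℝ, s' ≠ θ ∧ s' - θ < 2 * Real.pi ∧ θ - s' < 2 * Real.pi →
      P u ≠ Complex.exp (s' * Complex.I) := by
    intro s' hs' h
    have h6 : ρ = 1 := by rw [← h5, h, Complex.norm_exp_ofReal_mul_I]
    rw [h6, Complex.ofReal_one, one_mul] at e
    exact hs'.1 (exp_mul_I_inj (h.symm.trans e) hs'.2.1 hs'.2.2)
  rcases hP u (h5.trans_le h4) with h | h
  exacts [key s hs h, key t ht h]

/-- Two paths outside the unit disc which join alternating points of the unit circle meet. -/
theorem not_avoids_of_alternating {a b c d : ℝ} (hab : a < b) (hbc : b < c) (hcd : c < d)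
    (hda : d < a + 2 * Real.pi)
    (P : Path (Complex.exp (a * Complex.I)) (Complex.exp (c * Complex.I)))
    (Q : Path (Complex.exp (b * Complex.I)) (Complex.exp (d * Complex.I)))
    (hP : ∀ u, ‖P u‖ ≤ 1 → P u = Complex.exp (a * Complex.I) ∨ P u = Complex.exp (c * Complex.I))
    (hQ : ∀ u, ‖Q u‖ ≤ 1 → Q u = Complex.exp (b * Complex.I) ∨ Q u = Complex.exp (d * Complex.I)) :
    ¬ P.Avoids Q := by
  intro hPQ
  have hp := Real.pi_pos
  -- The arc closing the circle runs from `d` to `a + 2π`; its end is identified with the point at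
  -- angle `a`.
  have ha : Complex.exp (a * Complex.I) =
      Complex.exp (((a + 2 * Real.pi : ℝ) : ℂ) * Complex.I) := by
    push_cast
    rw [add_mul, Complex.exp_add, Complex.exp_two_pi_mul_I, mul_one]
  have hrange : Set.range ((circleArc d (a + 2 * Real.pi)).symm.cast ha rfl) =
      Set.range (circleArc d (a + 2 * Real.pi)) := by
    rw [← Path.symm_range (circleArc d (a + 2 * Real.pi))]; rfl
  have mid : ∀ {x y θ : ℝ}, x ≤ y → (y < θ ∨ θ < x) → y - θ < 2 * Real.pi → θ - x < 2 * Real.pi →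
      (circleArc x y).Avoids (spoke θ) := fun hxy h1 h2 h3 =>
    circleArc_avoids_spoke hxy fun r h4 h5 =>
      ⟨fun e => by rcases h1 with h1 | h1 <;> linarith, by linarith, by linarith⟩
  -- The vertices of K5 are the four points on the circle and the centre. `P` and `Q` are the only
  -- non-adjacent edges whose disjointness is not automatic.
  refine not_drawing_completeGraph_five (circleArc a b) P
    ((circleArc d (a + 2 * Real.pi)).symm.cast ha rfl) (spoke a) (circleArc b c) Q (spoke b)
    (circleArc c d) (spoke c) (spoke d)
    (circleArc_avoids_circleArc hab.le hcd.le hbc (by linarith))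
    (mid hab.le (Or.inl hbc) (by linarith) (by linarith))
    (mid hab.le (Or.inl (by linarith)) (by linarith) (by linarith)) hPQ
    (avoids_spoke P hP ⟨hab.ne, by linarith, by linarith⟩ ⟨hbc.ne', by linarith, by linarith⟩)
    (avoids_spoke P hP ⟨by linarith, by linarith, by linarith⟩ ⟨hcd.ne, by linarith, by linarith⟩)
    ?_ ?_ ?_
    (mid hbc.le (Or.inr hab) (by linarith) (by linarith)).symm
    (avoids_spoke Q hQ ⟨hab.ne', by linarith, by linarith⟩
      ⟨by linarith, by linarith, by linarith⟩).symm
    (mid hcd.le (Or.inr (by linarith)) (by linarith) (by linarith)).symm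
    (mid hbc.le (Or.inl hcd) (by linarith) (by linarith))
    (avoids_spoke Q hQ ⟨hbc.ne, by linarith, by linarith⟩ ⟨hcd.ne', by linarith, by linarith⟩)
    (mid hcd.le (Or.inr hbc) (by linarith) (by linarith)).symm
  · rw [Path.Avoids, hrange]
    exact (circleArc_avoids_circleArc hbc.le hda.le hcd (by linarith)).symm
  · rw [Path.Avoids, hrange]
    exact mid hda.le (Or.inr (by linarith)) (by linarith) (by linarith)
  · rw [Path.Avoids, hrange]
    exact mid hda.le (Or.inr (by linarith)) (by linarith) (by linarith)

/-- A path from a point outside a topological disc to the disc, inside a given round ball. -/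
theorem exists_path_to_disc (ψ : ℂ ≃ₜ ℂ) {x y : ℂ} {ε : ℝ} (hx : 1 < ‖ψ x‖) (hy : ‖ψ y‖ ≤ 1)
    (hyx : y ∈ Metric.ball x ε) :
    ∃ (q : ℂ) (γ : Path x q), ‖ψ q‖ = 1 ∧ Set.range γ ⊆ Metric.ball x ε ∧
      ∀ u, ‖ψ (γ u)‖ ≤ 1 → γ u = q := by
  set f : ℝ → ℂ := fun t => AffineMap.lineMap x y t with hf
  have hfc : Continuous f := AffineMap.lineMap_continuous
  have hg : Continuous fun t => ‖ψ (f t)‖ := (ψ.continuous.comp hfc).norm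
  have hK : IsCompact (Set.Icc (0 : ℝ) 1 ∩ {t | ‖ψ (f t)‖ ≤ 1}) :=
    isCompact_Icc.inter_right (isClosed_le hg continuous_const)
  -- `t` is the first time at which the segment from `x` to `y` reaches the disc; the path stops
  -- there.
  obtain ⟨t, ⟨ht, ht1⟩, hmin⟩ := hK.exists_isLeast ⟨1, ⟨by simp, by simpa [hf] using hy⟩⟩
  have ht0 : 0 < t := by
    rcases ht.1.lt_or_eq with h | h
    · exact h
    · rw [← h] at ht1
      have : ‖ψ x‖ ≤ 1 := by simpa [hf] using ht1
      linarith
  have heq : ‖ψ (f t)‖ = 1 := by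
    refine le_antisymm ht1 ?_
    by_contra! hlt
    obtain ⟨s, hs, hs1⟩ := intermediate_value_Icc' ht.1 hg.continuousOn
      (show (1 : ℝ) ∈ Set.Icc ‖ψ (f t)‖ ‖ψ (f 0)‖ from
        ⟨hlt.le, by simpa [hf] using hx.le⟩)
    have : t ≤ s := hmin ⟨⟨hs.1, hs.2.trans ht.2⟩, hs1.le⟩
    have : s = t := le_antisymm hs.2 this
    simp only [this] at hs1
    linarith
  refine ⟨f t, ⟨⟨fun u => f (u * t), by fun_prop⟩, by simp [hf], by simp⟩, heq, ?_, ?_⟩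
  · rintro _ ⟨u, rfl⟩
    have h1 : (u : ℝ) * t ∈ Set.Icc (0 : ℝ) 1 :=
      ⟨mul_nonneg u.2.1 ht.1, mul_le_one₀ u.2.2 ht.1 ht.2⟩
    exact (convex_ball x ε).lineMap_mem
      (Metric.mem_ball_self (dist_nonneg.trans_lt hyx)) hyx h1
  · intro u hu
    change f (u * t) = f t
    have h1 : (u : ℝ) * t ∈ Set.Icc (0 : ℝ) 1 :=
      ⟨mul_nonneg u.2.1 ht.1, mul_le_one₀ u.2.2 ht.1 ht.2⟩
    have h2 : t ≤ u * t := hmin ⟨h1, hu⟩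
    have h3 : (u : ℝ) * t ≤ t := mul_le_of_le_one_left ht.1 u.2.2
    rw [le_antisymm h3 h2]

/-! ### From a drawing to a convex placement -/

/-- A placement of the vertices in distinct places on a line (or, equivalently, on a circle) such
that every edge `ac`, regarded as a chord, is crossed by at most one other edge `bd`. -/
def IsConvexOnePlane {V : Type*} (G : SimpleGraph V) (p : V → ℕ) : Prop :=
  Function.Injective p ∧ ∀ a c b d b' d', G.Adj a c → G.Adj b d → G.Adj b' d' →
    p a < p b → p b < p c → (p d < p a ∨ p c < p d) →
    p a < p b' → p b' < p c → (p d' < p a ∨ p c < p d') → b = b' ∧ d = d'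

namespace PlaneDrawing

variable {V : Type*} {G : SimpleGraph V} (D : PlaneDrawing G)

theorem isCompact_arc (e : G.edgeSet) : IsCompact (D.arc e) := by
  obtain ⟨e, he⟩ := e
  induction e using Sym2.ind with
  | _ u v =>
    obtain ⟨γ, -, hγ⟩ := D.arc_spec u v he
    rw [← hγ]
    exact isCompact_range γ.continuous

theorem isCompact_carrier [Finite V] : IsCompact D.carrier :=
  (Set.finite_range D.point).isCompact.union (isCompact_iUnion D.isCompact_arc)

theorem point_mem_carrier (v : V) : D.point v ∈ D.carrier := Or.inl ⟨v, rfl⟩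

theorem arc_subset_carrier (e : G.edgeSet) : D.arc e ⊆ D.carrier :=
  (Set.subset_iUnion D.arc e).trans Set.subset_union_right

theorem outerFace_subset : D.outerFace ⊆ D.carrierᶜ := fun _ h => h.1

theorem isOpen_outerFace [Finite V] : IsOpen D.outerFace := by
  have ho : IsOpen D.carrierᶜ := D.isCompact_carrier.isClosed.isOpen_compl
  refine isOpen_iff_mem_nhds.2 fun p hp => ?_
  filter_upwards [(ho.connectedComponentIn (x := p)).mem_nhds (mem_connectedComponentIn hp.1)]
    with q hq
  exact ⟨connectedComponentIn_subset _ _ hq, by rw [← connectedComponentIn_eq hq]; exact hp.2⟩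

/-- The carrier is bounded, so the exterior of a large disc is connected and misses it. Every
unbounded component meets that exterior, so there is only one. -/
theorem isPreconnected_outerFace [Finite V] : IsPreconnected D.outerFace := by
  obtain ⟨r, hr⟩ := D.isCompact_carrier.isBounded.subset_closedBall 0
  set M := max r 1
  have hM : D.carrier ⊆ Metric.closedBall 0 M :=
    hr.trans (Metric.closedBall_subset_closedBall (le_max_left _ _))
  have hE : IsPreconnected {z : ℂ | dist z 0 ∈ Set.Ioi M} :=
    isPreconnected_dist_mem 0 isPreconnected_Ioi fun s hs =>
      (zero_lt_one.trans_le (le_max_right r 1)).trans hs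
  have hEc : {z : ℂ | dist z 0 ∈ Set.Ioi M} ⊆ D.carrierᶜ := fun z hz hz' =>
    not_lt.2 (Metric.mem_closedBall.1 (hM hz')) hz
  have hfar : ∀ p ∈ D.outerFace, ∃ q ∈ connectedComponentIn D.carrierᶜ p, M < dist q 0 := by
    intro p hp
    by_contra! hcon
    exact hp.2 (Metric.isBounded_closedBall.subset fun q hq => Metric.mem_closedBall.2 (hcon q hq))
  refine isPreconnected_of_forall_pair fun p hp q hq => ?_
  obtain ⟨p', hp', hpM⟩ := hfar p hp
  obtain ⟨q', hq', hqM⟩ := hfar q hq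
  have e1 := connectedComponentIn_eq hp'
  have e2 := connectedComponentIn_eq hq'
  have e3 : connectedComponentIn D.carrierᶜ p' = connectedComponentIn D.carrierᶜ q' :=
    connectedComponentIn_eq (hE.subset_connectedComponentIn hpM hEc hqM)
  refine ⟨connectedComponentIn D.carrierᶜ p, fun z hz => ?_, mem_connectedComponentIn hp.1, ?_,
    isPreconnected_connectedComponentIn⟩
  · exact ⟨connectedComponentIn_subset _ _ hz, by rw [← connectedComponentIn_eq hz]; exact hp.2⟩
  · rw [e1, e3, ← e2]; exact mem_connectedComponentIn hq.1

/-- Around the vertices there are pairwise disjoint discs that meet only the incident edges. -/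
theorem exists_radius [Finite V] : ∃ ε > 0,
    (∀ v w, v ≠ w → Disjoint (Metric.ball (D.point v) ε) (Metric.ball (D.point w) ε)) ∧
    ∀ (v : V) (e : G.edgeSet), v ∉ (e : Sym2 V) →
      Disjoint (Metric.ball (D.point v) ε) (D.arc e) := by
  have h1 : ∀ v w, v ≠ w → ∀ᶠ ε in 𝓝[>] (0 : ℝ),
      Disjoint (Metric.ball (D.point v) ε) (Metric.ball (D.point w) ε) := by
    intro v w hvw
    have hd : 0 < dist (D.point v) (D.point w) := dist_pos.2 (D.point_injective.ne hvw)
    filter_upwards [Ioo_mem_nhdsGT (half_pos hd)] with ε hε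
    exact Metric.ball_disjoint_ball (by linarith [hε.2])
  have h2 : ∀ (v : V) (e : G.edgeSet), v ∉ (e : Sym2 V) → ∀ᶠ ε in 𝓝[>] (0 : ℝ),
      Disjoint (Metric.ball (D.point v) ε) (D.arc e) := by
    intro v e hve
    have ho : IsOpen (D.arc e)ᶜ := (D.isCompact_arc e).isClosed.isOpen_compl
    obtain ⟨r, hr, hrs⟩ := Metric.isOpen_iff.1 ho (D.point v)
      fun h => hve (D.mem_of_point_mem_arc e v h)
    filter_upwards [Ioo_mem_nhdsGT hr] with ε hε
    exact Set.disjoint_left.2 fun z hz => hrs (Metric.ball_subset_ball hε.2.le hz)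
  have h3 : ∀ᶠ ε in 𝓝[>] (0 : ℝ), 0 < ε ∧
      (∀ v w, v ≠ w → Disjoint (Metric.ball (D.point v) ε) (Metric.ball (D.point w) ε)) ∧
      ∀ (v : V) (e : G.edgeSet), v ∉ (e : Sym2 V) →
        Disjoint (Metric.ball (D.point v) ε) (D.arc e) := by
    simp only [eventually_and, eventually_all]
    exact ⟨self_mem_nhdsWithin, fun v w => by simpa using h1 v w, fun v e => by simpa using h2 v e⟩
  obtain ⟨ε, h0, h⟩ := h3.exists
  exact ⟨ε, h0, h⟩

variable {D}

/-- If all vertices lie on the boundary of the outer face, then they can be ordered cyclically in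
such a way that alternating edges meet. -/
theorem exists_angle [Finite V] (hD : ∀ v, D.point v ∈ frontier D.outerFace) :
    ∃ θ : V → ℝ, Function.Injective θ ∧ ∀ (a b c d : V) (hac : G.Adj a c) (hbd : G.Adj b d),
      θ a < θ b → θ b < θ c → θ c < θ d →
      (D.arc ⟨s(a, c), hac⟩ ∩ D.arc ⟨s(b, d), hbd⟩).Nonempty := by
  cases isEmpty_or_nonempty V with
  | inl h => exact ⟨fun _ => 0, fun a => (h.false a).elim, fun a => (h.false a).elim⟩
  | inr hV =>
  obtain ⟨ε, hε, hball, harc⟩ := D.exists_radius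
  have hnear : ∀ v, ∃ y ∈ D.outerFace, y ∈ Metric.ball (D.point v) ε := fun v => by
    obtain ⟨y, hy, hyd⟩ := Metric.mem_closure_iff.1 (frontier_subset_closure (hD v)) ε hε
    exact ⟨y, hy, by rwa [Metric.mem_ball, dist_comm]⟩
  choose y hy hyball using hnear
  obtain ⟨φ, hφ, hφS⟩ := exists_homeomorph_closedBall D.isOpen_outerFace
    D.isPreconnected_outerFace ⟨y hV.some, hy _⟩ (Set.finite_range y).toFinset
    (fun s hs => by obtain ⟨v, rfl⟩ := (Set.Finite.mem_toFinset _).1 hs; exact hy v)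
  have hout : ∀ z ∈ D.carrier, 1 < ‖φ.symm z‖ := by
    intro z hz
    by_contra! h
    -- The disc lies in the outer face, hence misses the drawing.
    exact D.outerFace_subset (hφ ⟨φ.symm z, by simpa using h, by simp⟩) hz
  have hin : ∀ v, ‖φ.symm (y v)‖ ≤ 1 := by
    intro v
    obtain ⟨w, hw, e⟩ := hφS (y v) ((Set.Finite.mem_toFinset _).2 ⟨v, rfl⟩)
    rw [← e]; simpa using hw
  choose q leg hq hlegball hleg using fun v =>
    exists_path_to_disc φ.symm (hout _ (D.point_mem_carrier v)) (hin v) (hyball v)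
  have hθ : ∀ v, φ.symm (q v) = Complex.exp (Complex.arg (φ.symm (q v)) * Complex.I) := by
    intro v
    have := Complex.norm_mul_exp_arg_mul_I (φ.symm (q v))
    rw [hq, Complex.ofReal_one, one_mul] at this
    exact this.symm
  refine ⟨fun v => Complex.arg (φ.symm (q v)), fun v w h => ?_, ?_⟩
  · by_contra hvw
    have h1 : φ.symm (q v) = φ.symm (q w) := by
      rw [hθ v, hθ w]
      simp only at h
      rw [h]
    have h2 : q v = q w := φ.symm.injective h1
    exact Set.disjoint_left.1 (hball v w hvw) (hlegball v ⟨1, (leg v).target⟩)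
      (h2 ▸ hlegball w ⟨1, (leg w).target⟩)
  intro a b c d hac hbd h1 h2 h3
  have hpath : ∀ u v (huv : G.Adj u v), ∃ P : Path (q u) (q v),
      (∀ t, ‖φ.symm (P t)‖ ≤ 1 → P t = q u ∨ P t = q v) ∧
      Set.range P ⊆ Metric.ball (D.point u) ε ∪ D.arc ⟨s(u, v), huv⟩ ∪
        Metric.ball (D.point v) ε := by
    intro u v huv
    obtain ⟨γ, -, hγ⟩ := D.arc_spec u v huv
    refine ⟨((leg u).symm.trans γ).trans (leg v), ?_, ?_⟩
    · intro t ht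
      have : (((leg u).symm.trans γ).trans (leg v)) t ∈
          Set.range (((leg u).symm.trans γ).trans (leg v)) := ⟨t, rfl⟩
      rw [Path.trans_range, Path.trans_range, Path.symm_range] at this
      rcases this with (⟨s, hs⟩ | hs) | ⟨s, hs⟩
      · rw [← hs] at ht ⊢
        exact Or.inl (hleg u s ht)
      · rw [hγ] at hs
        exact absurd ht (not_le.2 (hout _ (D.arc_subset_carrier _ hs)))
      · rw [← hs] at ht ⊢
        exact Or.inr (hleg v s ht)
    · rw [Path.trans_range, Path.trans_range, Path.symm_range, hγ]
      exact Set.union_subset_union (Set.union_subset_union_left _ (hlegball u)) (hlegball v)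
  obtain ⟨P, hP, hPr⟩ := hpath a c hac
  obtain ⟨Q, hQ, hQr⟩ := hpath b d hbd
  have hPQ := not_avoids_of_alternating h1 h2 h3
    (by linarith [Complex.arg_le_pi (φ.symm (q d)), Complex.neg_pi_lt_arg (φ.symm (q a))])
    ((P.map φ.symm.continuous).cast (hθ a).symm (hθ c).symm)
    ((Q.map φ.symm.continuous).cast (hθ b).symm (hθ d).symm)
    (fun u hu => (hP u hu).imp (fun h => (congrArg φ.symm h).trans (hθ a))
      (fun h => (congrArg φ.symm h).trans (hθ c)))
    (fun u hu => (hQ u hu).imp (fun h => (congrArg φ.symm h).trans (hθ b))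
      (fun h => (congrArg φ.symm h).trans (hθ d)))
  obtain ⟨_, ⟨s, rfl⟩, ⟨t, ht⟩⟩ := Set.not_disjoint_iff.1 hPQ
  have hst : Q t = P s := φ.symm.injective ht
  have hsP := hPr ⟨s, rfl⟩
  have htQ := hQr ⟨t, rfl⟩
  rw [hst] at htQ
  have nab : a ≠ b := fun e => by rw [e] at h1; exact lt_irrefl _ h1
  have nbc : b ≠ c := fun e => by rw [e] at h2; exact lt_irrefl _ h2
  have ncd : c ≠ d := fun e => by rw [e] at h3; exact lt_irrefl _ h3
  have nad : a ≠ d := fun e => by rw [e] at h1; exact lt_asymm h1 (h2.trans h3)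
  have hb1 : b ∉ s(a, c) := by simp [nab.symm, nbc]
  have hd1 : d ∉ s(a, c) := by simp [nad.symm, ncd.symm]
  have ha1 : a ∉ s(b, d) := by simp [nab, nad]
  have hc1 : c ∉ s(b, d) := by simp [nbc.symm, ncd]
  -- The small balls are disjoint from each other and from non-incident edges, so the common point
  -- cannot lie in one of them unless it is on both arcs.
  rcases hsP with (hs | hs) | hs <;> rcases htQ with (ht' | ht') | ht'
  · exact absurd ht' (Set.disjoint_left.1 (hball a b nab) hs)
  · exact absurd ht' (Set.disjoint_left.1 (harc a ⟨s(b, d), hbd⟩ ha1) hs)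
  · exact absurd ht' (Set.disjoint_left.1 (hball a d nad) hs)
  · exact absurd hs (Set.disjoint_left.1 (harc b ⟨s(a, c), hac⟩ hb1) ht')
  · exact ⟨_, hs, ht'⟩
  · exact absurd hs (Set.disjoint_left.1 (harc d ⟨s(a, c), hac⟩ hd1) ht')
  · exact absurd ht' (Set.disjoint_left.1 (hball c b nbc.symm) hs)
  · exact absurd ht' (Set.disjoint_left.1 (harc c ⟨s(b, d), hbd⟩ hc1) hs)
  · exact absurd ht' (Set.disjoint_left.1 (hball c d ncd) hs)

/-- A common point of two non-adjacent edges is a crossing. -/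
theorem mem_crossings {e f : G.edgeSet} (h : ∀ w, w ∈ (e : Sym2 V) → w ∉ (f : Sym2 V)) {z : ℂ}
    (he : z ∈ D.arc e) (hf : z ∈ D.arc f) : (f, z) ∈ D.crossings e := by
  have hz : z ∉ Set.range D.point := by
    rintro ⟨w, rfl⟩
    exact h w (D.mem_of_point_mem_arc e w he) (D.mem_of_point_mem_arc f w hf)
  refine ⟨fun hfe => ?_, ⟨he, hz⟩, hf, hz⟩
  simp only at hfe
  subst hfe
  obtain ⟨e, _⟩ := f
  induction e using Sym2.ind with
  | _ u v => exact h u (Sym2.mem_mk_left u v) (Sym2.mem_mk_left u v)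

end PlaneDrawing

/-- Angles are replaced by their ranks. Alternating edges share a point and no end, so they cross,
and the bound on crossings transfers to chords. -/
theorem IsOuterOnePlanar.exists_isConvexOnePlane {V : Type*} [Fintype V] {G : SimpleGraph V}
    (h : IsOuterOnePlanar G) :
    ∃ p : V → ℕ, IsConvexOnePlane G p ∧ ∀ v, p v < Fintype.card V := by
  classical
  obtain ⟨D, hcr, hD⟩ := h
  obtain ⟨θ, hθ, hmeet⟩ := D.exists_angle hD
  set p : V → ℕ := fun v => (Finset.univ.filter fun w => θ w < θ v).card with hp
  have hmono : ∀ v w, θ v < θ w → p v < p w := fun v w hvw =>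
    Finset.card_lt_card <| by
      refine Finset.ssubset_iff_of_subset (fun u hu => ?_) |>.2 ⟨v, by simpa using hvw, by simp⟩
      simp only [Finset.mem_filter_univ] at hu ⊢
      exact hu.trans hvw
  have hlt : ∀ v w, p v < p w → θ v < θ w := by
    intro v w hvw
    by_contra! hle
    rcases hle.lt_or_eq with h | h
    · exact absurd hvw (hmono w v h).not_gt
    · rw [hθ h] at hvw; exact lt_irrefl _ hvw
  have hinj : Function.Injective p := by
    intro v w hvw
    by_contra hne
    rcases (hθ.ne hne).lt_or_gt with h | h
    · exact (hmono v w h).ne hvw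
    · exact (hmono w v h).ne' hvw
  have hcross : ∀ a c b d (hac : G.Adj a c) (hbd : G.Adj b d), p a < p b → p b < p c →
      (p d < p a ∨ p c < p d) → ∃ z, (⟨s(b, d), hbd⟩, z) ∈ D.crossings ⟨s(a, c), hac⟩ := by
    intro a c b d hac hbd h1 h2 h3
    have hne : ∀ w, w ∈ s(a, c) → w ∉ s(b, d) := by
      intro w hw hw'
      rw [Sym2.mem_iff] at hw hw'
      rcases hw with rfl | rfl <;> rcases hw' with e | e <;> subst e <;> omega
    have : (D.arc ⟨s(a, c), hac⟩ ∩ D.arc ⟨s(b, d), hbd⟩).Nonempty := by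
      rcases h3 with h3 | h3
      · obtain ⟨z, hz⟩ := hmeet d a b c hbd.symm hac (hlt _ _ h3) (hlt _ _ h1) (hlt _ _ h2)
        refine ⟨z, hz.2, ?_⟩
        have e : (⟨s(d, b), hbd.symm⟩ : G.edgeSet) = ⟨s(b, d), hbd⟩ := Subtype.ext Sym2.eq_swap
        rw [← e]; exact hz.1
      · exact hmeet a b c d hac hbd (hlt _ _ h1) (hlt _ _ h2) (hlt _ _ h3)
    obtain ⟨z, hz1, hz2⟩ := this
    exact ⟨z, PlaneDrawing.mem_crossings hne hz1 hz2⟩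
  refine ⟨p, ⟨hinj, ?_⟩, fun v => ?_⟩
  · intro a c b d b' d' hac hbd hbd' h1 h2 h3 h4 h5 h6
    obtain ⟨z, hz⟩ := hcross a c b d hac hbd h1 h2 h3
    obtain ⟨z', hz'⟩ := hcross a c b' d' hac hbd' h4 h5 h6
    have := congrArg (fun x => (x.1 : Sym2 V)) (hcr _ hz hz')
    simp only [Sym2.eq_iff] at this
    rcases this with h | ⟨rfl, rfl⟩
    · exact h
    · omega
  · exact Finset.card_lt_univ_of_notMem (x := v) (by simp)

/-! ### From a convex placement to a straight-line drawing -/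

/-- The rational parametrization of the unit circle. -/
noncomputable def circlePoint (t : ℝ) : ℂ := ⟨(1 - t ^ 2) / (1 + t ^ 2), 2 * t / (1 + t ^ 2)⟩

theorem norm_circlePoint (t : ℝ) : ‖circlePoint t‖ = 1 := by
  have h : ‖circlePoint t‖ ^ 2 = 1 := by
    rw [← Complex.normSq_eq_norm_sq, Complex.normSq_apply, circlePoint]
    have : (1 + t ^ 2) ≠ 0 := by positivity
    field_simp; ring
  exact (pow_eq_one_iff_of_nonneg (norm_nonneg _) two_ne_zero).1 h

/-- Twice the oriented area of a triangle. -/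
noncomputable def orientation (x y z : ℂ) : ℝ :=
  (y - x).re * (z - x).im - (y - x).im * (z - x).re

/-- A Vandermonde product with a positive factor: the order of the parameters decides on which side
of a chord a point of the circle lies. -/
theorem orientation_circlePoint (a b c : ℝ) :
    orientation (circlePoint a) (circlePoint b) (circlePoint c) =
      4 / ((1 + a ^ 2) * (1 + b ^ 2) * (1 + c ^ 2)) * ((b - a) * ((c - a) * (c - b))) := by
  have h1 : (1 + a ^ 2) ≠ 0 := by positivity
  have h2 : (1 + b ^ 2) ≠ 0 := by positivity
  have h3 : (1 + c ^ 2) ≠ 0 := by positivity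
  simp only [orientation, circlePoint, Complex.sub_re, Complex.sub_im]
  field_simp; ring

theorem orientation_lineMap (x y z w : ℂ) (t : ℝ) :
    orientation x y (AffineMap.lineMap z w t) =
      (1 - t) * orientation x y z + t * orientation x y w := by
  simp only [orientation, AffineMap.lineMap_apply_module, Complex.sub_re, Complex.sub_im,
    Complex.add_re, Complex.add_im, Complex.smul_re, Complex.smul_im, smul_eq_mul]
  ring

theorem orientation_eq_zero_of_mem_segment {x y z : ℂ} (h : z ∈ segment ℝ x y) :
    orientation x y z = 0 := by
  rw [segment_eq_image_lineMap] at h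
  obtain ⟨t, -, rfl⟩ := h
  rw [orientation_lineMap]
  simp only [orientation, Complex.sub_re, Complex.sub_im]; ring

theorem circlePoint_mem_segment {a b c : ℝ} (hab : a ≠ b)
    (h : circlePoint c ∈ segment ℝ (circlePoint a) (circlePoint b)) : c = a ∨ c = b := by
  have h := orientation_eq_zero_of_mem_segment h
  rw [orientation_circlePoint] at h
  have h0 : 4 / ((1 + a ^ 2) * (1 + b ^ 2) * (1 + c ^ 2)) ≠ 0 := by positivity
  simpa [h0, sub_eq_zero, hab.symm] using h

theorem circlePoint_injective : Function.Injective circlePoint := by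
  intro a b h
  have h1 : (1 - a ^ 2) / (1 + a ^ 2) = (1 - b ^ 2) / (1 + b ^ 2) := congrArg Complex.re h
  have h2 : 2 * a / (1 + a ^ 2) = 2 * b / (1 + b ^ 2) := congrArg Complex.im h
  rw [div_eq_div_iff (by positivity) (by positivity)] at h1 h2
  have h3 : a ^ 2 = b ^ 2 := by linarith
  rw [h3] at h2
  have : (1 + b ^ 2) ≠ 0 := by positivity
  have := mul_right_cancel₀ this h2
  linarith

/-- Orientation with respect to the chord `a c` is affine along `b d` and vanishes at an inner
point. Its end values therefore have opposite signs, unless both vanish and the chords coincide. -/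
theorem orientation_neg_of_crossing {a b c d : ℝ} (hac : a ≠ c) (hbd : b ≠ d) {z : ℂ}
    (h1 : z ∈ segment ℝ (circlePoint a) (circlePoint c))
    (h2 : z ∈ segment ℝ (circlePoint b) (circlePoint d))
    (hzb : z ≠ circlePoint b) (hzd : z ≠ circlePoint d)
    (hne : ¬ (b = a ∧ d = c)) (hne' : ¬ (b = c ∧ d = a)) :
    orientation (circlePoint a) (circlePoint c) (circlePoint b) *
      orientation (circlePoint a) (circlePoint c) (circlePoint d) < 0 := by
  have h0 := orientation_eq_zero_of_mem_segment h1
  rw [segment_eq_image_lineMap] at h2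
  obtain ⟨t, ht, rfl⟩ := h2
  have ht0 : 0 < t := ht.1.lt_of_ne fun h => hzb (by simp [← h])
  have ht1 : 0 < 1 - t := sub_pos.2 <| ht.2.lt_of_ne fun h => hzd (by simp [h])
  rw [orientation_lineMap] at h0
  have hz : ∀ x, orientation (circlePoint a) (circlePoint c) (circlePoint x) = 0 →
      x = a ∨ x = c := by
    intro x hx
    rw [orientation_circlePoint] at hx
    have h0 : 4 / ((1 + a ^ 2) * (1 + c ^ 2) * (1 + x ^ 2)) ≠ 0 := by positivity
    simpa [h0, sub_eq_zero, hac.symm] using hx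
  set β := orientation (circlePoint a) (circlePoint c) (circlePoint b)
  set δ := orientation (circlePoint a) (circlePoint c) (circlePoint d)
  by_cases hβ : β = 0
  · have hδ : δ = 0 := by
      rw [hβ] at h0
      simpa [ht0.ne'] using h0
    rcases hz b hβ with rfl | rfl <;> rcases hz d hδ with rfl | rfl
    exacts [absurd rfl hbd, absurd ⟨rfl, rfl⟩ hne, absurd ⟨rfl, rfl⟩ hne', absurd rfl hbd]
  · have : (1 - t) * (β * β) + t * (β * δ) = 0 := by linear_combination β * h0
    have hpos : 0 < β * β := mul_self_pos.2 hβ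
    by_contra! hcon
    nlinarith [mul_pos ht1 hpos, mul_nonneg ht0.le hcon]

theorem alternating_of_crossing {a b c d : ℝ} (hac : a < c)
    (h : orientation (circlePoint a) (circlePoint c) (circlePoint b) *
      orientation (circlePoint a) (circlePoint c) (circlePoint d) < 0) :
    (a < b ∧ b < c ∧ (d < a ∨ c < d)) ∨ (a < d ∧ d < c ∧ (b < a ∨ c < b)) := by
  rw [orientation_circlePoint, orientation_circlePoint] at h
  have hk : ∀ x : ℝ, 0 < 4 / ((1 + a ^ 2) * (1 + c ^ 2) * (1 + x ^ 2)) := fun x => by positivity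
  have h2 : ((b - a) * (b - c)) * ((d - a) * (d - c)) < 0 := by
    have e : ∀ k l x y w : ℝ, k * (w * x) * (l * (w * y)) = (k * l * (w * w)) * (x * y) := by
      intros; ring
    rw [e] at h
    have hw : 0 < c - a := sub_pos.2 hac
    exact (pos_iff_neg_of_mul_neg h).1 (mul_pos (mul_pos (hk b) (hk d)) (mul_pos hw hw))
  have inside : ∀ x : ℝ, (x - a) * (x - c) < 0 → a < x ∧ x < c := by
    intro x hx
    constructor <;> by_contra! hcon <;> nlinarith
  have outside : ∀ x : ℝ, 0 < (x - a) * (x - c) → x < a ∨ c < x := by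
    intro x hx
    by_contra! hcon
    nlinarith [mul_nonneg (sub_nonneg.2 hcon.1) (sub_nonneg.2 hcon.2)]
  rcases mul_neg_iff.1 h2 with ⟨h3, h4⟩ | ⟨h3, h4⟩
  · exact Or.inr ⟨(inside d h4).1, (inside d h4).2, outside b h3⟩
  · exact Or.inl ⟨(inside b h3).1, (inside b h3).2, outside d h4⟩

/-- The straight line drawing with vertices on the unit circle. -/
noncomputable def circleDrawing {V : Type*} (G : SimpleGraph V) (p : V → ℕ)
    (hp : Function.Injective p) : PlaneDrawing G where
  point v := circlePoint (p v)
  point_injective v w h := hp (by exact_mod_cast circlePoint_injective h)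
  -- The convex hull of the two ends needs no ordering of the unordered pair.
  arc e := convexHull ℝ ((fun v => circlePoint (p v)) '' {w | w ∈ (e : Sym2 V)})
  arc_spec u v h := by
    have hne : circlePoint (p u) ≠ circlePoint (p v) := fun e =>
      h.ne (hp (by exact_mod_cast circlePoint_injective e))
    have e : {w | w ∈ s(u, v)} = ({u, v} : Set V) := by ext w; simp
    exact ⟨Path.segment _ _, Path.segment_injective_of_ne hne, by
      rw [Path.range_segment, e, Set.image_pair, convexHull_pair]⟩
  mem_of_point_mem_arc e w h := by
    obtain ⟨e, he⟩ := e
    induction e using Sym2.ind with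
    | _ u v =>
      have e : {w | w ∈ s(u, v)} = ({u, v} : Set V) := by ext w; simp
      simp only [e, Set.image_pair, convexHull_pair] at h
      have huv : (p u : ℝ) ≠ p v := by
        exact_mod_cast hp.ne (G.ne_of_adj (G.mem_edgeSet.1 he))
      rcases circlePoint_mem_segment huv h with h | h
      · have : w = u := hp (by exact_mod_cast h)
        simp [this]
      · have : w = v := hp (by exact_mod_cast h)
        simp [this]

section

variable {V : Type*} {G : SimpleGraph V} {p : V → ℕ} (hp : Function.Injective p)

theorem circleDrawing_arc {u v : V} (h : G.Adj u v) :
    (circleDrawing G p hp).arc ⟨s(u, v), h⟩ =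
      segment ℝ (circlePoint (p u)) (circlePoint (p v)) := by
  have e : {w | w ∈ s(u, v)} = ({u, v} : Set V) := by ext w; simp
  simp only [circleDrawing, e, Set.image_pair, convexHull_pair]

theorem circleDrawing_carrier_subset : (circleDrawing G p hp).carrier ⊆ Metric.closedBall 0 1 := by
  have h : ∀ v : V, circlePoint (p v) ∈ Metric.closedBall 0 1 := fun v => by
    simp [norm_circlePoint]
  refine Set.union_subset (Set.range_subset_iff.2 h) (Set.iUnion_subset fun e => ?_)
  refine convexHull_min ?_ (convex_closedBall _ _)
  rintro _ ⟨v, -, rfl⟩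
  exact h v

theorem circleDrawing_mem_frontier (v : V) :
    (circleDrawing G p hp).point v ∈ frontier (circleDrawing G p hp).outerFace := by
  set D := circleDrawing G p hp
  have hsub : {z : ℂ | dist z 0 ∈ Set.Ioi 1} ⊆ D.carrierᶜ := fun z hz hz' =>
    not_lt.2 (Metric.mem_closedBall.1 (circleDrawing_carrier_subset hp hz')) hz
  have hpre : IsPreconnected {z : ℂ | dist z 0 ∈ Set.Ioi (1 : ℝ)} :=
    isPreconnected_dist_mem 0 isPreconnected_Ioi fun s hs => zero_lt_one.trans hs
  have hout : {z : ℂ | dist z 0 ∈ Set.Ioi 1} ⊆ D.outerFace := by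
    intro z hz
    refine ⟨hsub hz, fun hb => ?_⟩
    obtain ⟨r, hr⟩ := hb.subset_closedBall 0
    have hw : ((|r| + 2 : ℝ) : ℂ) ∈ {z : ℂ | dist z 0 ∈ Set.Ioi 1} := by
      simp only [Set.mem_ofPred_eq, dist_zero_right, Complex.norm_real, Real.norm_eq_abs,
        Set.mem_Ioi]
      rw [abs_of_pos (by positivity)]
      linarith [abs_nonneg r]
    have := hr (hpre.subset_connectedComponentIn hz hsub hw)
    simp only [Metric.mem_closedBall, dist_zero_right, Complex.norm_real, Real.norm_eq_abs] at this
    rw [abs_of_pos (by positivity)] at this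
    linarith [le_abs_self r]
  refine ⟨?_, fun h => D.outerFace_subset (interior_subset h) (D.point_mem_carrier v)⟩
  refine closure_mono hout (Metric.mem_closure_iff.2 fun ε hε => ?_)
  refine ⟨((1 + ε / 2 : ℝ) : ℂ) * circlePoint (p v), ?_, ?_⟩
  · simp only [Set.mem_ofPred_eq, dist_zero_right, norm_mul, Complex.norm_real, Real.norm_eq_abs,
      norm_circlePoint, Set.mem_Ioi, mul_one]
    rw [abs_of_pos (by positivity)]
    linarith
  · have : D.point v - ((1 + ε / 2 : ℝ) : ℂ) * circlePoint (p v) =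
        ((-(ε / 2) : ℝ) : ℂ) * circlePoint (p v) := by
      change circlePoint (p v) - _ = _
      push_cast; ring
    rw [dist_eq_norm, this, norm_mul, norm_circlePoint, Complex.norm_real, Real.norm_eq_abs,
      abs_neg, abs_of_pos (by positivity)]
    linarith

theorem exists_crossing_ends {a c : V} (hac : G.Adj a c) (hlt : p a < p c) {f : G.edgeSet} {z : ℂ}
    (h : (f, z) ∈ (circleDrawing G p hp).crossings ⟨s(a, c), hac⟩) :
    ∃ (b d : V) (hbd : G.Adj b d), f = ⟨s(b, d), hbd⟩ ∧ p a < p b ∧ p b < p c ∧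
      (p d < p a ∨ p c < p d) ∧ z ∈ segment ℝ (circlePoint (p b)) (circlePoint (p d)) ∧
      orientation (circlePoint (p a)) (circlePoint (p c)) z = 0 ∧
      orientation (circlePoint (p a)) (circlePoint (p c)) (circlePoint (p b)) *
        orientation (circlePoint (p a)) (circlePoint (p c)) (circlePoint (p d)) < 0 := by
  obtain ⟨f, hf⟩ := f
  induction f using Sym2.ind with
  | _ b d =>
    have hbd : G.Adj b d := hf
    obtain ⟨hne, hz1, hz2⟩ := h
    have hz3 : z ∈ (circleDrawing G p hp).arc ⟨s(a, c), hac⟩ := hz1.1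
    have hz4 : z ∈ (circleDrawing G p hp).arc ⟨s(b, d), hbd⟩ := hz2.1
    rw [circleDrawing_arc] at hz3 hz4
    have hz5 : ∀ v, z ≠ circlePoint (p v) := fun v e => hz1.2 ⟨v, e.symm⟩
    have hn : ∀ v w, (p v : ℝ) = p w → v = w := fun v w h => hp (by exact_mod_cast h)
    have hneg := orientation_neg_of_crossing (a := p a) (b := p b) (c := p c) (d := p d)
      (by exact_mod_cast hlt.ne) (fun h => hbd.ne (hn _ _ h)) hz3 hz4 (hz5 b) (hz5 d)
      (fun h => hne (Subtype.ext (show s(b, d) = s(a, c) by rw [hn _ _ h.1, hn _ _ h.2])))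
      (fun h => hne (Subtype.ext (show s(b, d) = s(a, c) by
        rw [hn _ _ h.1, hn _ _ h.2, Sym2.eq_swap])))
    rcases alternating_of_crossing (by exact_mod_cast hlt) hneg with h | h
    · exact ⟨b, d, hbd, rfl, by exact_mod_cast h.1, by exact_mod_cast h.2.1,
        by exact_mod_cast h.2.2, hz4, orientation_eq_zero_of_mem_segment hz3, hneg⟩
    · exact ⟨d, b, hbd.symm, Subtype.ext Sym2.eq_swap, by exact_mod_cast h.1,
        by exact_mod_cast h.2.1, by exact_mod_cast h.2.2, by
          rwa [segment_symm],
        orientation_eq_zero_of_mem_segment hz3, by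
          rwa [mul_comm]⟩

end

/-- This makes maximality usable: an edge whose addition keeps the placement convex one-plane must
already be present. -/
theorem IsConvexOnePlane.isOuterOnePlanar {V : Type*} {G : SimpleGraph V} {p : V → ℕ}
    (h : IsConvexOnePlane G p) : IsOuterOnePlanar G := by
  obtain ⟨hp, hcr⟩ := h
  refine ⟨circleDrawing G p hp, ?_, circleDrawing_mem_frontier hp⟩
  have key : ∀ a c (hac : G.Adj a c), p a < p c →
      ((circleDrawing G p hp).crossings ⟨s(a, c), hac⟩).Subsingleton := by
    rintro a c hac hlt ⟨f, z⟩ hz ⟨f', z'⟩ hz'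
    obtain ⟨b, d, hbd, rfl, h1, h2, h3, h4, h5, h6⟩ := exists_crossing_ends hp hac hlt hz
    obtain ⟨b', d', hbd', rfl, h1', h2', h3', h4', h5', -⟩ := exists_crossing_ends hp hac hlt hz'
    obtain ⟨rfl, rfl⟩ := hcr a c b d b' d' hac hbd hbd' h1 h2 h3 h1' h2' h3'
    rw [segment_eq_image_lineMap] at h4 h4'
    obtain ⟨t, -, rfl⟩ := h4
    obtain ⟨t', -, rfl⟩ := h4'
    rw [orientation_lineMap] at h5 h5'
    set β := orientation (circlePoint (p a)) (circlePoint (p c)) (circlePoint (p b))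
    set δ := orientation (circlePoint (p a)) (circlePoint (p c)) (circlePoint (p d))
    have hβδ : δ - β ≠ 0 := fun e => by
      rw [sub_eq_zero.1 e] at h6
      exact absurd h6 (mul_self_nonneg β).not_gt
    have : t = t' := by
      apply mul_right_cancel₀ hβδ
      linear_combination h5 - h5'
    rw [this]
  rintro ⟨e, he⟩
  induction e using Sym2.ind with
  | _ a c =>
    rcases (hp.ne (G.ne_of_adj (G.mem_edgeSet.1 he))).lt_or_gt with hlt | hlt
    · exact key a c he hlt
    · have e : (⟨s(a, c), he⟩ : G.edgeSet) = ⟨s(c, a), (G.mem_edgeSet.1 he).symm⟩ :=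
        Subtype.ext Sym2.eq_swap
      rw [e]
      exact key c a _ hlt

/-! ### Systems of chords crossed at most once -/

/-- No edge of the relation `A` crosses the chord from `i` to `j`. -/
def Uncrossed (A : ℕ → ℕ → Prop) (i j : ℕ) : Prop :=
  ∀ x y, A x y → i < x → x < j → i ≤ y ∧ y ≤ j

/-- A symmetric irreflexive relation on the points of a line such that every related pair, regarded as
a chord, is crossed by at most one other related pair. -/
structure CrossedOnce (A : ℕ → ℕ → Prop) : Prop where
  symm : ∀ i j, A i j → A j i
  irrefl : ∀ i, ¬ A i i
  cross : ∀ a c b d b' d', A a c → A b d → A b' d' → a < b → b < c → (d < a ∨ c < d) →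
    a < b' → b' < c → (d' < a ∨ c < d') → b = b' ∧ d = d'

namespace CrossedOnce

variable {A : ℕ → ℕ → Prop}

/-- An edge crossing one of these four chords would also cross `a c` or `b d`, which already cross
each other. -/
theorem uncrossed_sides (hA : CrossedOnce A) {a b c d : ℕ} (hac : A a c) (hbd : A b d)
    (h1 : a < b) (h2 : b < c) (h3 : c < d) :
    Uncrossed A a b ∧ Uncrossed A b c ∧ Uncrossed A c d ∧ Uncrossed A a d := by
  have C1 : ∀ x y, A x y → a < x → x < c → (y < a ∨ c < y) → x = b ∧ y = d :=
    fun x y h h4 h5 h6 => hA.cross a c x y b d hac h hbd h4 h5 h6 h1 h2 (Or.inr h3)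
  have C2 : ∀ x y, A x y → b < x → x < d → (y < b ∨ d < y) → x = c ∧ y = a :=
    fun x y h h4 h5 h6 => hA.cross b d x y c a hbd h (hA.symm _ _ hac) h4 h5 h6 h2 h3 (Or.inl h1)
  refine ⟨?_, ?_, ?_, ?_⟩ <;> intro x y h h4 h5 <;>
    (have h' := hA.symm _ _ h
     have c1 := C1 x y h
     have c2 := C1 y x h'
     have c3 := C2 x y h
     have c4 := C2 y x h'
     omega)

/-- The region below an uncrossed chord is a triangle or a quadrangle with both diagonals. -/
theorem exists_cell (hA : CrossedOnce A) {i j : ℕ} (hij : i + 2 ≤ j) (hU : Uncrossed A i j) :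
    (∃ k, i < k ∧ k < j ∧ Uncrossed A i k ∧ Uncrossed A k j) ∨
    ∃ k l, i < k ∧ k < l ∧ l < j ∧ Uncrossed A i k ∧ Uncrossed A k l ∧ Uncrossed A l j := by
  classical
  -- Take the greatest `k` with `i k` uncrossed. If `k j` is crossed, the crossing edge must end at
  -- `i`, since it cannot cross `i k` or `i j`. By maximality that edge is crossed in turn, and the
  -- crossing edge must end at `j`; these two edges are the diagonals.
  set S := (Finset.Ioo i j).filter fun k => Uncrossed A i k with hS
  have hne : S.Nonempty := ⟨i + 1, by
    simp only [hS, Finset.mem_filter, Finset.mem_Ioo]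
    exact ⟨by omega, fun x y _ h1 h2 => by omega⟩⟩
  obtain ⟨k, hk, hmax⟩ := S.exists_max_image id hne
  simp only [hS, Finset.mem_filter, Finset.mem_Ioo, id] at hk hmax
  obtain ⟨⟨hik, hkj⟩, hUk⟩ := hk
  by_cases hUkj : Uncrossed A k j
  · exact Or.inl ⟨k, hik, hkj, hUk, hUkj⟩
  obtain ⟨x, y, hxy, hkx, hxj, hy⟩ : ∃ x y, A x y ∧ k < x ∧ x < j ∧ ¬ (k ≤ y ∧ y ≤ j) := by
    simpa only [Uncrossed, not_forall, exists_prop] using hUkj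
  have h1 := hU x y hxy (by omega) hxj
  have h2 := hUk y x (hA.symm _ _ hxy)
  have hyi : y = i := by omega
  subst hyi
  have hnx : ¬ Uncrossed A y x := fun h => by
    have := hmax x ⟨⟨by omega, hxj⟩, h⟩
    omega
  obtain ⟨u, w, huw, hyu, hux, hw⟩ : ∃ u w, A u w ∧ y < u ∧ u < x ∧ ¬ (y ≤ w ∧ w ≤ x) := by
    simpa only [Uncrossed, not_forall, exists_prop] using hnx
  have h3 := hU u w huw hyu (by omega)
  obtain ⟨s1, s2, s3, s4⟩ := hA.uncrossed_sides (hA.symm _ _ hxy) huw hyu hux (by omega)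
  rcases h3.2.lt_or_eq with hwj | rfl
  · have := hmax w ⟨⟨by omega, hwj⟩, s4⟩
    omega
  · exact Or.inr ⟨u, x, hyu, hux, hxj, s1, s2, s3⟩

end CrossedOnce

/-! ### Neighbourhoods below uncrossed chords, and maximality -/

section

variable {V : Type*} {G : SimpleGraph V} {p : V → ℕ}

/-- The adjacency relation of a graph on the places of its vertices. -/
def AdjAt (G : SimpleGraph V) (p : V → ℕ) (i j : ℕ) : Prop :=
  ∃ u v, p u = i ∧ p v = j ∧ G.Adj u v

theorem IsConvexOnePlane.crossedOnce (h : IsConvexOnePlane G p) : CrossedOnce (AdjAt G p) where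
  symm := by
    rintro i j ⟨u, v, hu, hv, huv⟩
    exact ⟨v, u, hv, hu, huv.symm⟩
  irrefl := by
    rintro i ⟨u, v, hu, hv, huv⟩
    exact huv.ne (h.1 (hu.trans hv.symm))
  cross := by
    rintro _ _ _ _ _ _ ⟨a, c, rfl, rfl, hac⟩ ⟨b, d, rfl, rfl, hbd⟩ ⟨b', d', rfl, rfl, hbd'⟩
      h1 h2 h3 h4 h5 h6
    obtain ⟨rfl, rfl⟩ := h.2 a c b d b' d' hac hbd hbd' h1 h2 h3 h4 h5 h6
    exact ⟨rfl, rfl⟩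

theorem adjAt_mem_Icc_erase (h : IsConvexOnePlane G p) {i j k y : ℕ} (hik : i < k) (hkj : k < j)
    (hU : Uncrossed (AdjAt G p) i j) (hy : AdjAt G p k y) : y ∈ (Finset.Icc i j).erase k :=
  Finset.mem_erase.2 ⟨fun e => h.crossedOnce.irrefl k (e ▸ hy),
    Finset.mem_Icc.2 (hU k y hy hik hkj)⟩

theorem card_Icc_erase {i j k : ℕ} (hik : i < k) (hkj : k < j) :
    ((Finset.Icc i j).erase k).card = j - i := by
  rw [Finset.card_erase_of_mem (Finset.mem_Icc.2 ⟨hik.le, hkj.le⟩), Nat.card_Icc]; omega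

/-- An inner corner `k` of a quadrangle sees nothing strictly between `l` and `j`, as `l j` is
uncrossed. This lowers its degree bound to `l - i + 1`. -/
theorem adjAt_mem_left (h : IsConvexOnePlane G p) {i j k l y : ℕ}
    (hik : i < k) (hkl : k < l) (hlj : l < j)
    (hU : Uncrossed (AdjAt G p) i j) (hU' : Uncrossed (AdjAt G p) l j) (hy : AdjAt G p k y) :
    y ∈ insert j ((Finset.Icc i l).erase k) := by
  have h1 := adjAt_mem_Icc_erase h hik (hkl.trans hlj) hU hy
  have h2 := hU' y k (h.crossedOnce.symm _ _ hy)
  simp only [Finset.mem_erase, Finset.mem_Icc, Finset.mem_insert] at h1 ⊢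
  omega

theorem adjAt_mem_right (h : IsConvexOnePlane G p) {i j k l y : ℕ}
    (hik : i < k) (hkl : k < l) (hlj : l < j)
    (hU : Uncrossed (AdjAt G p) i j) (hU' : Uncrossed (AdjAt G p) i k) (hy : AdjAt G p l y) :
    y ∈ insert i ((Finset.Icc k j).erase l) := by
  have h1 := adjAt_mem_Icc_erase h (hik.trans hkl) hlj hU hy
  have h2 := hU' y l (h.crossedOnce.symm _ _ hy)
  simp only [Finset.mem_erase, Finset.mem_Icc, Finset.mem_insert] at h1 ⊢
  omega

variable [Fintype V]

theorem lt_of_adjAt (hlt : ∀ v, p v < Fintype.card V) {i j : ℕ} (hij : AdjAt G p i j) :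
    i < Fintype.card V ∧ j < Fintype.card V := by
  obtain ⟨u, v, rfl, rfl, -⟩ := hij
  exact ⟨hlt u, hlt v⟩

theorem uncrossed_univ (hlt : ∀ v, p v < Fintype.card V) :
    Uncrossed (AdjAt G p) 0 (Fintype.card V - 1) := fun x y hxy _ _ => by
  have := lt_of_adjAt hlt hxy
  omega

/-- In a maximal outer-1-planar graph, a chord that would be crossed by at most one edge, where this
edge is uncrossed, is an edge. -/
theorem adjAt_of_isMaximalOuterOnePlanar (h : IsConvexOnePlane G p)
    (hmax : IsMaximalOuterOnePlanar G)
    (hsurj : ∀ i < Fintype.card V, ∃ v, p v = i) {x y a b : ℕ} (hxy : x < y)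
    (hy : y < Fintype.card V)
    (hab : ∀ s t, AdjAt G p s t → x < s → s < y → (t < x ∨ y < t) → s = a ∧ t = b)
    (hU : Uncrossed (AdjAt G p) (min a b) (max a b)) : AdjAt G p x y := by
  obtain ⟨u, rfl⟩ := hsurj x (hxy.trans hy)
  obtain ⟨v, rfl⟩ := hsurj y hy
  by_contra hnot
  have hne : u ≠ v := fun e => by rw [e] at hxy; exact lt_irrefl _ hxy
  refine hmax.2 u v hne (fun e => hnot ⟨u, v, rfl, rfl, e⟩)
    (IsConvexOnePlane.isOuterOnePlanar (p := p) ⟨h.1, ?_⟩)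
  have hadj : ∀ s t, (G ⊔ SimpleGraph.edge u v).Adj s t →
      G.Adj s t ∨ s = u ∧ t = v ∨ s = v ∧ t = u := by
    intro s t hst
    rw [SimpleGraph.sup_adj, SimpleGraph.edge_adj] at hst
    tauto
  -- The only old edge that the new chord can cross is `a b`, and no old edge crosses it, so it
  -- gains its first crossing.
  have hend : ∀ s t s' t', G.Adj s t → (s' = u ∧ t' = v ∨ s' = v ∧ t' = u) → p s < p s' →
      p s' < p t → (p t' < p s ∨ p t < p t') → ∀ x y, G.Adj x y → p s < p x → p x < p t →
      p s ≤ p y ∧ p y ≤ p t := by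
    intro s t s' t' hst hs h1 h2 h3 x y hxy' h4 h5
    have e : min a b = p s ∧ max a b = p t := by
      have c1 := hab (p s) (p t) ⟨s, t, rfl, rfl, hst⟩
      have c2 := hab (p t) (p s) ⟨t, s, rfl, rfl, hst.symm⟩
      rcases hs with ⟨rfl, rfl⟩ | ⟨rfl, rfl⟩
      · have := c2 (by omega) (by omega) (by omega)
        omega
      · have := c1 (by omega) (by omega) (by omega)
        omega
    rw [e.1, e.2] at hU
    exact hU _ _ ⟨x, y, rfl, rfl, hxy'⟩ h4 h5
  have hnew : ∀ s t, G.Adj s t → p u < p s → p s < p v → (p t < p u ∨ p v < p t) →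
      p s = a ∧ p t = b := fun s t hst => hab _ _ ⟨s, t, rfl, rfl, hst⟩
  intro a' c b' d b'' d' eac ebd ebd' h1 h2 h3 h4 h5 h6
  suffices p b' = p b'' ∧ p d = p d' from ⟨h.1 this.1, h.1 this.2⟩
  rcases hadj _ _ eac with hac | hac
  · rcases hadj _ _ ebd with hbd | hbd <;> rcases hadj _ _ ebd' with hbd' | hbd'
    · have := h.2 _ _ _ _ _ _ hac hbd hbd' h1 h2 h3 h4 h5 h6
      rw [this.1, this.2]
      exact ⟨rfl, rfl⟩
    · have := hend _ _ _ _ hac hbd' h4 h5 h6 _ _ hbd h1 h2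
      omega
    · have := hend _ _ _ _ hac hbd h1 h2 h3 _ _ hbd' h4 h5
      omega
    · clear hend hnew hab hadj
      rcases hbd with ⟨e1, e2⟩ | ⟨e1, e2⟩ <;> rcases hbd' with ⟨e3, e4⟩ | ⟨e3, e4⟩ <;>
        (replace e1 := congrArg p e1
         replace e2 := congrArg p e2
         replace e3 := congrArg p e3
         replace e4 := congrArg p e4
         omega)
  · have hac' : a' = u ∧ c = v := hac.resolve_right fun e => by
      have e1 := congrArg p e.1
      have e2 := congrArg p e.2
      omega
    obtain ⟨rfl, rfl⟩ := hac'
    have old : ∀ s t, (G ⊔ SimpleGraph.edge a' c).Adj s t → p a' < p s → p s < p c →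
        G.Adj s t := fun s t hst l1 l2 => by
      rcases hadj s t hst with e | e | e
      · exact e
      · rw [e.1] at l1; omega
      · rw [e.1] at l2; omega
    have g1 := hnew _ _ (old _ _ ebd h1 h2) h1 h2 h3
    have g2 := hnew _ _ (old _ _ ebd' h4 h5) h4 h5 h6
    omega

theorem adjAt_of_uncrossed (h : IsConvexOnePlane G p)
    (hmax : IsMaximalOuterOnePlanar G)
    (hsurj : ∀ i < Fintype.card V, ∃ v, p v = i) {x y : ℕ} (hxy : x < y)
    (hy : y < Fintype.card V) (hU : Uncrossed (AdjAt G p) x y) : AdjAt G p x y :=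
  -- No edge crosses the chord, so the values 0 are dummies.
  adjAt_of_isMaximalOuterOnePlanar h hmax hsurj hxy hy (a := 0) (b := 0)
    (fun s t hst h1 h2 h3 => by have := hU s t hst h1 h2; omega)
    (fun s t _ h1 h2 => by simp at h2)

theorem adjAt_succ (h : IsConvexOnePlane G p)
    (hmax : IsMaximalOuterOnePlanar G)
    (hsurj : ∀ i < Fintype.card V, ∃ v, p v = i) {x : ℕ}
    (hx : x + 1 < Fintype.card V) : AdjAt G p x (x + 1) :=
  adjAt_of_uncrossed h hmax hsurj (by omega) hx fun s t _ h1 h2 => by omega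

variable [DecidableRel G.Adj]

theorem degree_le_card_of_adjAt (hp : Function.Injective p) {u : V} {T : Finset ℕ}
    (hT : ∀ y, AdjAt G p (p u) y → y ∈ T) : G.degree u ≤ T.card := by
  rw [← G.card_neighborFinset_eq_degree]
  refine Finset.card_le_card_of_injOn p (fun w hw => ?_) hp.injOn
  exact hT _ ⟨u, w, rfl, rfl, by simpa using hw⟩

theorem adjAt_of_card_le_degree (hp : Function.Injective p) {u : V} {T : Finset ℕ}
    (hT : ∀ y, AdjAt G p (p u) y → y ∈ T) (hcard : T.card ≤ G.degree u) {y : ℕ} (hy : y ∈ T) :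
    AdjAt G p (p u) y := by
  have hsub : (G.neighborFinset u).image p ⊆ T := by
    intro y hy
    obtain ⟨w, hw, rfl⟩ := Finset.mem_image.1 hy
    exact hT _ ⟨u, w, rfl, rfl, by simpa using hw⟩
  have := Finset.eq_of_subset_of_card_le hsub
    (by rwa [Finset.card_image_of_injective _ hp, G.card_neighborFinset_eq_degree])
  rw [← this] at hy
  obtain ⟨w, hw, rfl⟩ := Finset.mem_image.1 hy
  exact ⟨u, w, rfl, rfl, by simpa using hw⟩

/-! ### Light edges -/

/-- There is an edge whose ends have degree sum at most `m`. -/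
def HasLightEdge (G : SimpleGraph V) [DecidableRel G.Adj] (m : ℕ) : Prop :=
  ∃ u v : V, G.Adj u v ∧ G.degree u + G.degree v ≤ m

theorem hasLightEdge_of_adjAt (hp : Function.Injective p) {c k m : ℕ} (h : AdjAt G p c k)
    {S T : Finset ℕ} (hS : ∀ y, AdjAt G p c y → y ∈ S) (hT : ∀ y, AdjAt G p k y → y ∈ T)
    (hm : S.card + T.card ≤ m) : HasLightEdge G m := by
  obtain ⟨u, v, rfl, rfl, huv⟩ := h
  exact ⟨u, v, huv, (add_le_add (degree_le_card_of_adjAt hp hS)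
    (degree_le_card_of_adjAt hp hT)).trans hm⟩

/-- Below an uncrossed chord there is a light edge, or the chord spans at most two vertices and its
ends have a common neighbour of degree two below it. -/
theorem hasLightEdge_or_leaf (h : IsConvexOnePlane G p) (hδ : ∀ v, 2 ≤ G.degree v)
    (hsurj : ∀ i < Fintype.card V, ∃ v, p v = i)
    (i j : ℕ) (hij : i + 2 ≤ j) (hj : j < Fintype.card V) (hU : Uncrossed (AdjAt G p) i j) :
    HasLightEdge G 9 ∨ (j ≤ i + 3 ∧ ∃ c, AdjAt G p c i ∧ AdjAt G p c j ∧
      ∀ y, AdjAt G p c y → y ∈ ({i, j} : Finset ℕ)) := by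
  induction hn : j - i using Nat.strong_induction_on generalizing i j with
  | _ n ih =>
  have sub : ∀ a b, i ≤ a → a < b → b ≤ j → b - a < j - i → Uncrossed (AdjAt G p) a b →
      HasLightEdge G 9 ∨ b = a + 1 ∨ (b ≤ a + 3 ∧ ∃ c, AdjAt G p c a ∧ AdjAt G p c b ∧
        ∀ y, AdjAt G p c y → y ∈ ({a, b} : Finset ℕ)) := by
    intro a b h1 h2 h3 h4 h5
    by_cases hab : b = a + 1
    · exact Or.inr (Or.inl hab)
    · exact (ih (b - a) (by omega) a b (by omega) (by omega) h5 rfl).imp_right Or.inr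
  by_cases hL : HasLightEdge G 9
  · exact Or.inl hL
  have leaf : ∀ c, c < Fintype.card V → (∀ y, AdjAt G p c y → y ∈ ({i, j} : Finset ℕ)) →
      AdjAt G p c i ∧ AdjAt G p c j := by
    intro c hc hy
    obtain ⟨u, rfl⟩ := hsurj c hc
    have hcard : ({i, j} : Finset ℕ).card ≤ G.degree u := Finset.card_le_two.trans (hδ u)
    exact ⟨adjAt_of_card_le_degree h.1 hy hcard (by simp),
      adjAt_of_card_le_degree h.1 hy hcard (by simp)⟩
  rcases h.crossedOnce.exists_cell hij hU with ⟨k, hik, hkj, hU1, hU2⟩ |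
    ⟨k, l, hik, hkl, hlj, hU1, hU2, hU3⟩
  · have hk := fun y => adjAt_mem_Icc_erase h hik hkj hU (y := y)
    have hkc := card_Icc_erase hik hkj
    have s1 := (sub i k le_rfl hik hkj.le (by omega) hU1).resolve_left hL
    have s2 := (sub k j hik.le hkj le_rfl (by omega) hU2).resolve_left hL
    rcases s1 with e1 | ⟨l1, c, -, hc, hc2⟩
    · rcases s2 with e2 | ⟨l2, c, hc, -, hc2⟩
      · refine Or.inr ⟨by omega, k, ?_⟩
        have hk' : ∀ y, AdjAt G p k y → y ∈ ({i, j} : Finset ℕ) := fun y hy => by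
          have := hk y hy
          simp only [Finset.mem_erase, Finset.mem_Icc, Finset.mem_insert,
            Finset.mem_singleton] at this ⊢
          omega
        exact ⟨(leaf k (by omega) hk').1, (leaf k (by omega) hk').2, hk'⟩
      · exact Or.inl (hasLightEdge_of_adjAt h.1 hc hc2 hk
          ((add_le_add Finset.card_le_two hkc.le).trans (by omega)))
    · exact Or.inl (hasLightEdge_of_adjAt h.1 hc hc2 hk
        ((add_le_add Finset.card_le_two hkc.le).trans (by omega)))
  · have hk := fun y => adjAt_mem_left h hik hkl hlj hU hU3 (y := y)
    have hl := fun y => adjAt_mem_right h hik hkl hlj hU hU1 (y := y)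
    have hkc := (Finset.card_insert_le j ((Finset.Icc i l).erase k)).trans_eq
      (congrArg (· + 1) (card_Icc_erase hik hkl))
    have hlc := (Finset.card_insert_le i ((Finset.Icc k j).erase l)).trans_eq
      (congrArg (· + 1) (card_Icc_erase hkl hlj))
    have s1 := (sub i k le_rfl hik (by omega) (by omega) hU1).resolve_left hL
    have s2 := (sub k l hik.le hkl (by omega) (by omega) hU2).resolve_left hL
    have s3 := (sub l j (by omega) hlj le_rfl (by omega) hU3).resolve_left hL
    have b1 : k ≤ i + 3 := by rcases s1 with e | e <;> omega
    have b2 : l ≤ k + 3 := by rcases s2 with e | e <;> omega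
    have b3 : j ≤ l + 3 := by rcases s3 with e | e <;> omega
    rcases s1 with e1 | ⟨-, c, -, hc, hc2⟩
    · rcases s2 with e2 | ⟨-, c, hc, -, hc2⟩
      · rcases s3 with e3 | ⟨-, c, hc, -, hc2⟩
        -- Here `i`, `k`, `l`, `j` are consecutive: either `k l` is an edge of weight at most 6, or
        -- `k` sees only `i` and `j`.
        · by_cases hadj : AdjAt G p k l
          · exact Or.inl (hasLightEdge_of_adjAt h.1 hadj hk hl
              ((add_le_add hkc hlc).trans (by omega)))
          · refine Or.inr ⟨by omega, k, ?_⟩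
            have hk' : ∀ y, AdjAt G p k y → y ∈ ({i, j} : Finset ℕ) := fun y hy => by
              have := hk y hy
              have hyl : y ≠ l := fun e => hadj (e ▸ hy)
              simp only [Finset.mem_erase, Finset.mem_Icc, Finset.mem_insert,
                Finset.mem_singleton] at this ⊢
              omega
            exact ⟨(leaf k (by omega) hk').1, (leaf k (by omega) hk').2, hk'⟩
        · exact Or.inl (hasLightEdge_of_adjAt h.1 hc hc2 hl
            ((add_le_add Finset.card_le_two hlc).trans (by omega)))
      · exact Or.inl (hasLightEdge_of_adjAt h.1 hc hc2 hk
          ((add_le_add Finset.card_le_two hkc).trans (by omega)))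
    · exact Or.inl (hasLightEdge_of_adjAt h.1 hc hc2 hk
        ((add_le_add Finset.card_le_two hkc).trans (by omega)))

/-- An outer-1-planar graph with minimum degree at least two has an edge of weight at most nine. -/
theorem IsConvexOnePlane.hasLightEdge_nine (h : IsConvexOnePlane G p) [Nonempty V]
    (hδ : ∀ v, 2 ≤ G.degree v)
    (hlt : ∀ v, p v < Fintype.card V) (hsurj : ∀ i < Fintype.card V, ∃ v, p v = i) :
    HasLightEdge G 9 := by
  have hn : 3 ≤ Fintype.card V := by
    have := hδ (Classical.arbitrary V)
    have := G.degree_lt_card_verts (Classical.arbitrary V)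
    omega
  rcases hasLightEdge_or_leaf h hδ hsurj 0 (Fintype.card V - 1) (by omega) (by omega)
    (uncrossed_univ hlt) with hL | ⟨hle, c, hc, -, hc2⟩
  · exact hL
  · refine hasLightEdge_of_adjAt h.1 hc hc2 (T := Finset.range (Fintype.card V))
      (fun y hy => Finset.mem_range.2 (lt_of_adjAt hlt hy).2)
      ((add_le_add Finset.card_le_two (Finset.card_range _).le).trans (by omega))

/-- In a maximal outer-1-planar graph there is a light edge below every uncrossed chord that spans
more than one vertex. -/
theorem hasLightEdge_or_eq (h : IsConvexOnePlane G p)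
    (hmax : IsMaximalOuterOnePlanar G)
    (hsurj : ∀ i < Fintype.card V, ∃ v, p v = i)
    (i j : ℕ) (hij : i + 2 ≤ j) (hj : j < Fintype.card V) (hU : Uncrossed (AdjAt G p) i j) :
    HasLightEdge G 7 ∨ j = i + 2 := by
  induction hn : j - i using Nat.strong_induction_on generalizing i j with
  | _ n ih =>
  by_cases hL : HasLightEdge G 7
  · exact Or.inl hL
  have sub : ∀ a b, i ≤ a → a < b → b ≤ j → b - a < j - i → Uncrossed (AdjAt G p) a b →
      b = a + 1 ∨ b = a + 2 := by
    intro a b h1 h2 h3 h4 h5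
    by_cases hab : b = a + 1
    · exact Or.inl hab
    · exact Or.inr ((ih (b - a) (by omega) a b (by omega) (by omega) h5 rfl).resolve_left hL)
  rcases h.crossedOnce.exists_cell hij hU with ⟨k, hik, hkj, hU1, hU2⟩ |
    ⟨k, l, hik, hkl, hlj, hU1, hU2, hU3⟩
  · rcases sub i k le_rfl hik hkj.le (by omega) hU1 with e1 | e1
    · rcases sub k j hik.le hkj le_rfl (by omega) hU2 with e2 | e2
      · exact Or.inr (by omega)
      -- Only an edge `k j`, itself uncrossed, could cross the chord from `i` to `k + 1`. Maximality
      -- makes this chord an edge, which contradicts that `k j` is uncrossed.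
      · have hadj := adjAt_of_isMaximalOuterOnePlanar h hmax hsurj (x := i) (y := k + 1)
          (a := k) (b := j) (by omega) (by omega) (fun s t hst h1 h2 h3 => by
            have c1 := hU s t hst
            have c2 := hU1 s t hst
            omega) (by rwa [min_eq_left hkj.le, max_eq_right hkj.le])
        have := hU2 _ _ (h.crossedOnce.symm _ _ hadj)
        omega
    · have hadj := adjAt_of_isMaximalOuterOnePlanar h hmax hsurj (x := i + 1) (y := j)
        (a := k) (b := i) (by omega) (by omega) (fun s t hst h1 h2 h3 => by
          have c1 := hU s t hst
          have c2 := hU2 s t hst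
          omega) (by rwa [min_eq_right hik.le, max_eq_left hik.le])
      have := hU1 _ _ hadj
      omega
  · have hk := fun y => adjAt_mem_left h hik hkl hlj hU hU3 (y := y)
    have hl := fun y => adjAt_mem_right h hik hkl hlj hU hU1 (y := y)
    have hkc := (Finset.card_insert_le j ((Finset.Icc i l).erase k)).trans_eq
      (congrArg (· + 1) (card_Icc_erase hik hkl))
    have hlc := (Finset.card_insert_le i ((Finset.Icc k j).erase l)).trans_eq
      (congrArg (· + 1) (card_Icc_erase hkl hlj))
    have leaf : ∀ a b, b = a + 2 → b < Fintype.card V → Uncrossed (AdjAt G p) a b →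
        AdjAt G p (a + 1) a ∧ AdjAt G p (a + 1) b ∧
        (∀ y, AdjAt G p (a + 1) y → y ∈ (Finset.Icc a b).erase (a + 1)) ∧
        ((Finset.Icc a b).erase (a + 1)).card = 2 := by
      rintro a _ rfl hb hab
      refine ⟨h.crossedOnce.symm _ _ (adjAt_succ h hmax hsurj (by omega)),
        adjAt_succ h hmax hsurj (by omega),
        fun y => adjAt_mem_Icc_erase h (by omega) (by omega) hab, ?_⟩
      rw [card_Icc_erase (by omega) (by omega)]; omega
    have s1 := sub i k le_rfl hik (by omega) (by omega) hU1
    have s2 := sub k l hik.le hkl (by omega) (by omega) hU2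
    have s3 := sub l j (by omega) hlj le_rfl (by omega) hU3
    refine Or.inl ?_
    by_cases e1 : k = i + 2
    · obtain ⟨-, f2, f3, f4⟩ := leaf i k e1 (by omega) hU1
      exact hasLightEdge_of_adjAt h.1 f2 f3 hk ((add_le_add f4.le hkc).trans (by omega))
    by_cases e2 : l = k + 2
    · obtain ⟨f1, -, f3, f4⟩ := leaf k l e2 (by omega) hU2
      exact hasLightEdge_of_adjAt h.1 f1 f3 hk ((add_le_add f4.le hkc).trans (by omega))
    by_cases e3 : j = l + 2
    · obtain ⟨f1, -, f3, f4⟩ := leaf l j e3 (by omega) hU3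
      exact hasLightEdge_of_adjAt h.1 f1 f3 hl ((add_le_add f4.le hlc).trans (by omega))
    exact hasLightEdge_of_adjAt h.1 (adjAt_of_uncrossed h hmax hsurj hkl (by omega) hU2)
      (fun y => adjAt_mem_Icc_erase h hik (hkl.trans hlj) hU)
      (fun y => adjAt_mem_Icc_erase h (hik.trans hkl) hlj hU)
      ((add_le_add (card_Icc_erase hik (hkl.trans hlj)).le
        (card_Icc_erase (hik.trans hkl) hlj).le).trans (by omega))

/-- A maximal outer-1-planar graph has an edge of weight at most seven. -/
theorem IsConvexOnePlane.hasLightEdge_seven (h : IsConvexOnePlane G p)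
    (hmax : IsMaximalOuterOnePlanar G)
    (hcard : 2 ≤ Fintype.card V)
    (hlt : ∀ v, p v < Fintype.card V) (hsurj : ∀ i < Fintype.card V, ∃ v, p v = i) :
    HasLightEdge G 7 := by
  have small : Fintype.card V ≤ 3 → HasLightEdge G 7 := fun hle =>
    have hrange : ∀ x y, AdjAt G p x y → y ∈ Finset.range (Fintype.card V) := fun x y hy =>
      Finset.mem_range.2 (lt_of_adjAt hlt hy).2
    hasLightEdge_of_adjAt h.1 (adjAt_succ h hmax hsurj (x := 0) (by omega)) (hrange _) (hrange _)
      (by rw [Finset.card_range]; omega)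
  by_cases hle : Fintype.card V ≤ 3
  · exact small hle
  · rcases hasLightEdge_or_eq h hmax hsurj 0 (Fintype.card V - 1) (by omega) (by omega)
      (uncrossed_univ hlt) with hL | e
    · exact hL
    · omega

end

theorem corollary2p5 {V : Type*} [Fintype V] (G : SimpleGraph V) [DecidableRel G.Adj] :
    (IsOuterOnePlanar G → 2 ≤ G.minDegree →
      ∃ u v : V, G.Adj u v ∧ G.degree u + G.degree v ≤ 9) ∧
    (IsMaximalOuterOnePlanar G → 2 ≤ Fintype.card V →
      ∃ u v : V, G.Adj u v ∧ G.degree u + G.degree v ≤ 7) := by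
  have key : IsOuterOnePlanar G → ∃ p : V → ℕ, IsConvexOnePlane G p ∧
      (∀ v, p v < Fintype.card V) ∧ ∀ i < Fintype.card V, ∃ v, p v = i := by
    intro hG
    obtain ⟨p, hp, hlt⟩ := hG.exists_isConvexOnePlane
    refine ⟨p, hp, hlt, fun i hi => ?_⟩
    have hbij : Function.Bijective fun v => (⟨p v, hlt v⟩ : Fin (Fintype.card V)) :=
      (Fintype.bijective_iff_injective_and_card _).2
        ⟨fun v w e => hp.1 (congrArg Fin.val e), by simp⟩
    obtain ⟨v, hv⟩ := hbij.2 ⟨i, hi⟩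
    exact ⟨v, congrArg Fin.val hv⟩
  refine ⟨fun hG hδ => ?_, fun hG hcard => ?_⟩
  · obtain ⟨p, hp, hlt, hsurj⟩ := key hG
    cases isEmpty_or_nonempty V with
    -- On an empty vertex set `minDegree` takes the default value 0.
    | inl hV => simp at hδ
    | inr hV => exact hp.hasLightEdge_nine (fun v => hδ.trans (G.minDegree_le_degree v)) hlt hsurj
  · obtain ⟨p, hp, hlt, hsurj⟩ := key hG.1
    exact hp.hasLightEdge_seven hG hcard hlt hsurj
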